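/- Let $n\ge 2$. For a Schwartz function $f$ on $\mathbb{R}^N$ let $\hat f(\xi)=\int e^{-2\pi i x\cdot\xi}f(x)\,dx$. For a hypersurface $S\subset\mathbb{R}^N$, or a compact subset of one, equipped with a measure $d\sigma$ (restricted to the subset in the second case), and for $1\le p,q\le\infty$, we say that $R_S(p\to q)$ holds if there is a finite constant $C$ such that $$\|\hat f|_S\|_{L^q(S,d\sigma)}\le C\,\|f\|_{L^p(\mathbb{R}^N)}\qquad\text{for all Schwartz functions } f \text{ on } \mathbb{R}^N .$$ Consider, with $\xi=(\xi',\xi_n)\in\mathbb{R}^{n-1}\times\mathbb{R}$, - the sphere $\{\xi\in\mathbb{R}^n: |\xi|=1\}$ with the usual surface measure; - the paraboloid $\{\xi\in\mathbb{R}^n:\xi_n=\tfrac12|\xi'|^2\}$ with the measure corresponding to $d\xi'$ under the projection $\xi\mapsto\xi'$; - the hyperboloid $\{\xi\in\mathbb{R}^n:\xi_n=\sqrt{1+|\xi'|^2}\}$ with the measure corresponding to $d\xi'/\sqrt{1+|\xi'|^2}$ under the projection $\xi\mapsto\xi'$; - the light cone $\{(\xi,\tau)\in\mathbb{R}^{n+1}:\tau=|\xi|,\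 \xi\ne0\}$ with the Lorentz-invariant measure, corresponding to $d\xi/|\xi|$ under the projection $(\xi,\tau)\mapsto\xi$. Let $1\le p,q\le\infty$ and let $p'$ be the exponent conjugate to $p$, $\frac1p+\frac1{p'}=1$. **(a)** Suppose that $$\frac{p'}{n+1}\ge\frac{q}{n-1},\qquad p'>\frac{2n}{n-1},$$ and that at least one of the following holds: (i) $R_S(p\to q)$ for the sphere $S$ in $\mathbb{R}^n$; (ii) $R_S(p\to q)$ for every compact subset $S$ of the paraboloid in $\mathbb{R}^n$; (iii) $R_S(p\to q)$ for every compact subset $S$ of the hyperboloid in $\mathbb{R}^n$. Then $R_S(p\to q)$ holds for every compact subset $S$ of the light cone in $\mathbb{R}^{n+1}$. **(b)** Suppose that $$\frac{p'}{n+1}=\frac{q}{n-1},\qquad p'>\frac{2n}{n-1},$$ and that at least one of the following holds: (i)$'$ $R_S(p\to q)$ for the sphere $S$ in $\mathbb{R}^n$; (ii)$'$ $R_S(p\to q)$ for the whole paraboloid $S$ in $\mathbb{R}^n$; (iii)$'$ $R_S(p\to q)$ for the whole hyperboloid $S$ in $\mathbb{R}^n$. Then $R_S(p\to q)$, with the same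 $p,q$, holds for the whole light cone $S$ in $\mathbb{R}^{n+1}$. -/

import Mathlib

open MeasureTheory
open scoped ENNReal NNReal SchwartzMap FourierTransform

noncomputable section

/-- The estimate `‖f̂‖_{L^q(σ)} ≤ C ‖f‖_{L^p(ℝ^N)}` for all Schwartz functions `f` on `ℝ^N`, where
`f̂(ξ) = ∫ f(x) e^{-2πi x·ξ} dx`.  For a measure `σ` carried by a hypersurface `S` this is the
restriction estimate `R_S(p → q)`.  The constant `C` is finite and independent of `f`. -/
def RestrictionEstimate {N : ℕ} (σ : Measure (EuclideanSpace ℝ (Fin N))) (p q : ℝ≥0∞) : Prop :=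
  ∃ C : ℝ≥0, ∀ f : 𝓢(EuclideanSpace ℝ (Fin N), ℂ),
    eLpNorm (fun ξ => 𝓕 (f : EuclideanSpace ℝ (Fin N) → ℂ) ξ) q σ ≤
      C * eLpNorm (fun x => f x) p volume

/-- `R_K(p → q)` for every compact subset `K` of the hypersurface `S` carrying the measure `σ`. -/
def CompactRestrictionEstimate {N : ℕ} (S : Set (EuclideanSpace ℝ (Fin N)))
    (σ : Measure (EuclideanSpace ℝ (Fin N))) (p q : ℝ≥0∞) : Prop :=
  ∀ K : Set (EuclideanSpace ℝ (Fin N)), IsCompact K → K ⊆ S →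
    RestrictionEstimate (σ.restrict K) p q

/-- The point `(ξ, s)` of `ℝ^{d+1} = ℝ^d × ℝ`. -/
def snocPoint {d : ℕ} (ξ : EuclideanSpace ℝ (Fin d)) (s : ℝ) : EuclideanSpace ℝ (Fin (d + 1)) :=
  WithLp.toLp 2 (Fin.snoc (α := fun _ => ℝ) (fun i => ξ i) s)

/-- The usual surface measure of the unit sphere of `ℝ^N`, as a measure on `ℝ^N`. -/
def sphereMeasure (N : ℕ) : Measure (EuclideanSpace ℝ (Fin N)) :=
  (volume : Measure (EuclideanSpace ℝ (Fin N))).toSphere.map Subtype.val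

/-- The paraboloid `ξ_n = |ξ'|² / 2` in `ℝ^n`, `n = d + 1`. -/
def paraboloid (d : ℕ) : Set (EuclideanSpace ℝ (Fin (d + 1))) :=
  {η | ∃ ξ : EuclideanSpace ℝ (Fin d), η = snocPoint ξ (‖ξ‖ ^ 2 / 2)}

/-- The measure on the paraboloid that corresponds to `dξ'` under `(ξ', ξ_n) ↦ ξ'`. -/
def paraboloidMeasure (d : ℕ) : Measure (EuclideanSpace ℝ (Fin (d + 1))) :=
  (volume : Measure (EuclideanSpace ℝ (Fin d))).map fun ξ => snocPoint ξ (‖ξ‖ ^ 2 / 2)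

/-- The (elliptic) hyperboloid `ξ_n = √(1 + |ξ'|²)` in `ℝ^n`, `n = d + 1`. -/
def hyperboloid (d : ℕ) : Set (EuclideanSpace ℝ (Fin (d + 1))) :=
  {η | ∃ ξ : EuclideanSpace ℝ (Fin d), η = snocPoint ξ (√(1 + ‖ξ‖ ^ 2))}

/-- The measure on the hyperboloid that corresponds to `dξ' / √(1 + |ξ'|²)` under
`(ξ', ξ_n) ↦ ξ'`. -/
def hyperboloidMeasure (d : ℕ) : Measure (EuclideanSpace ℝ (Fin (d + 1))) :=
  ((volume : Measure (EuclideanSpace ℝ (Fin d))).withDensity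
    fun ξ => ENNReal.ofReal (1 / √(1 + ‖ξ‖ ^ 2))).map fun ξ => snocPoint ξ (√(1 + ‖ξ‖ ^ 2))

/-- The light cone `τ = |ξ|`, `ξ ≠ 0`, in `ℝ^{n+1}`. -/
def lightCone (n : ℕ) : Set (EuclideanSpace ℝ (Fin (n + 1))) :=
  {η | ∃ ξ : EuclideanSpace ℝ (Fin n), ξ ≠ 0 ∧ η = snocPoint ξ ‖ξ‖}

/-- The Lorentz-invariant measure on the light cone, which corresponds to `dξ / |ξ|` under
`(ξ, τ) ↦ ξ`. -/
def lightConeMeasure (n : ℕ) : Measure (EuclideanSpace ℝ (Fin (n + 1))) :=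
  ((volume : Measure (EuclideanSpace ℝ (Fin n))).withDensity
    fun ξ => ENNReal.ofReal (1 / ‖ξ‖)).map fun ξ => snocPoint ξ ‖ξ‖

/-- `p' / (n + 1) ≥ q / (n - 1)` and `p' > 2n / (n - 1)`, for `n ≥ 2`; `p'` is the exponent
conjugate to `p`. -/
def RestrictionRange (n : ℕ) (p' q : ℝ≥0∞) : Prop :=
  q / ((n : ℝ≥0∞) - 1) ≤ p' / ((n : ℝ≥0∞) + 1) ∧ 2 * (n : ℝ≥0∞) / ((n : ℝ≥0∞) - 1) < p'

/-- `p' / (n + 1) = q / (n - 1)` and `p' > 2n / (n - 1)`, for `n ≥ 2`; `p'` is the exponent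
conjugate to `p`. -/
def ScaleInvariantRange (n : ℕ) (p' q : ℝ≥0∞) : Prop :=
  p' / ((n : ℝ≥0∞) + 1) = q / ((n : ℝ≥0∞) - 1) ∧ 2 * (n : ℝ≥0∞) / ((n : ℝ≥0∞) - 1) < p'

end

/-! The light cone is a cone over each of the three surfaces. Write a point of it as `(x, s, τ)`
with `τ² = |x|² + s²`. The slices at fixed `τ` are dilated spheres. Those at fixed `s > 0` are
dilated hyperboloids. Those at a fixed null coordinate `u = (τ + s)/√2` are dilated paraboloids,
because `v = (τ - s)/√2` satisfies `2uv = |x|²`. In each case the invariant measure becomes `u^{d-1}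
du` times the given measure on the slice, where `n = d + 1` and `u` is the axial variable
(`conicalMeasure`). The orthogonal changes of variables do not affect restriction estimates.

On the slice at height `u`, the Fourier transform of `f` is the `n`-dimensional Fourier transform of
the partial Fourier transform `f_u` of `f` in the axial variable. The assumed estimate, applied to a
dilate of the Schwartz function `f_u`, bounds the contribution of that slice by a power of `u` times
`‖f_u‖_p^q`. What remains is to integrate over `u`, which is one-dimensional Fourier analysis on the
lines with `x` fixed.

For compact pieces `u` stays in some `[a, b]` with `a > 0`, so the power of `u` is harmless.
Hausdorff–Young on each line and Minkowski's inequality bound `‖f_u‖_p` in `L^{p'}(du)`, and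
Hölder's inequality descends to the exponent `q ≤ p'` (`RestrictionBound.conicalMeasure_Icc`).

In the scale invariant case the total power is `u^{-2/(d+2)}` and `u` runs over the half-line.
Paley's inequality controls `∫ ‖f_u‖_p^p u^{p-2} du` and Hausdorff–Young controls `∫ ‖f_u‖_p^{p'}
du`. Hölder's inequality between these two gives exactly the weight and exponent required
(`RestrictionBound.conicalMeasure_Ioi`).

Finitely many isometries reduce compact pieces to the half `s > 0`, and the reflection `ξ ↦ -ξ` does
the same for the whole cone in the hyperboloid case. The endpoint `p = 1` is the bound `‖f̂‖_∞ ≤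
‖f‖_1`. -/

/-! ### Inequalities for the Fourier transform on the line: Plancherel, Minkowski, Paley,
Hausdorff–Young. -/

theorem integral_fourier_smul_eq_integral_smul_fourier {g φ : ℝ → ℂ} (hg : Integrable g)
    (hφ : Integrable φ) : ∫ u, φ u • 𝓕 g u = ∫ x, 𝓕 φ x • g x := by
  have h := VectorFourier.integral_fourierIntegral_smul_eq_flip (L := innerₗ ℝ) (μ := volume)
    (ν := volume) Real.continuous_fourierChar continuous_inner hφ hg
  rw [flip_innerₗ] at h
  exact h.symm

/-- **Plancherel's theorem** for integrable square integrable functions on the line. -/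
theorem lintegral_enorm_fourier_sq {g : ℝ → ℂ} (hg : Integrable g) (hg2 : MemLp g 2) :
    ∫⁻ u, ‖𝓕 g u‖ₑ ^ 2 = ∫⁻ x, ‖g x‖ₑ ^ 2 := by
  set G : Lp ℂ 2 (volume : Measure ℝ) := hg2.toLp g with hG
  have hcont : Continuous (𝓕 g) :=
    VectorFourier.fourierIntegral_continuous Real.continuous_fourierChar
      (by exact continuous_inner) hg
  -- The `L²` transform satisfies the Plancherel identity in Mathlib. It agrees a.e. with the
  -- Fourier integral because both give the same result against every test function, by the
  -- multiplication formula.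
  have hae : ∀ᵐ u, (𝓕 G : Lp ℂ 2 (volume : Measure ℝ)) u = 𝓕 g u := by
    refine ae_eq_of_integral_contDiff_smul_eq ?_ hcont.locallyIntegrable ?_
    · exact (Lp.memLp (𝓕 G)).locallyIntegrable (by norm_num)
    intro φ hφ hφc
    let ψ : ℝ → ℂ := fun x => (φ x : ℂ)
    have hψc : HasCompactSupport ψ := hφc.comp_left (g := fun x : ℝ => (x : ℂ)) (by simp)
    have hψ : ContDiff ℝ (↑(⊤ : ℕ∞)) ψ := Complex.ofRealCLM.contDiff.comp hφ
    let Ψ : 𝓢(ℝ, ℂ) := hψc.toSchwartzMap hψ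
    have h1 := DFunLike.congr_fun (Lp.fourier_toTemperedDistribution_eq G) Ψ
    rw [TemperedDistribution.fourier_apply, Lp.toTemperedDistribution_apply,
      Lp.toTemperedDistribution_apply] at h1
    have h2 := integral_fourier_smul_eq_integral_smul_fourier hg Ψ.integrable
    have h3 : ∫ x, (𝓕 Ψ) x • G x = ∫ x, 𝓕 (Ψ : ℝ → ℂ) x • g x := by
      refine integral_congr_ae ?_
      filter_upwards [hg2.coeFn_toLp] with x hx
      rw [hG, hx, SchwartzMap.fourier_coe]
    calc ∫ x, φ x • (𝓕 G : Lp ℂ 2 (volume : Measure ℝ)) x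
        = ∫ x, Ψ x • (𝓕 G : Lp ℂ 2 (volume : Measure ℝ)) x := by
          refine integral_congr_ae (.of_forall fun x => ?_)
          simp [Ψ, ψ]
      _ = ∫ x, Ψ x • 𝓕 g x := by rw [← h1, h3, h2]
      _ = ∫ x, φ x • 𝓕 g x := by
          refine integral_congr_ae (.of_forall fun x => ?_)
          simp [Ψ, ψ]
  have hpow : ∀ h : ℝ → ℂ, ∫⁻ x, ‖h x‖ₑ ^ 2 = eLpNorm h 2 volume ^ 2 := fun h => by
    have := eLpNorm_nnreal_pow_eq_lintegral (f := h) (μ := volume) (p := 2) (by norm_num)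
    simp only [NNReal.coe_ofNat, ENNReal.coe_ofNat, ENNReal.rpow_ofNat] at this
    exact this.symm
  rw [hpow, hpow, ← eLpNorm_congr_ae hae, ← eLpNorm_congr_ae hg2.coeFn_toLp]
  have := Lp.norm_fourier_eq G
  rw [Lp.norm_def, Lp.norm_def, ENNReal.toReal_eq_toReal_iff' (Lp.eLpNorm_ne_top _)
    (Lp.eLpNorm_ne_top _)] at this
  rw [this]

theorem enorm_fourier_le_lintegral (g : ℝ → ℂ) (u : ℝ) : ‖𝓕 g u‖ₑ ≤ ∫⁻ x, ‖g x‖ₑ := by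
  rw [Real.fourier_eq]
  refine (enorm_integral_le_lintegral_enorm _).trans (le_of_eq ?_)
  refine lintegral_congr fun x => ?_
  rw [← ofReal_norm, ← ofReal_norm, Circle.norm_smul]

theorem setLIntegral_Ioc_rpow {a r : ℝ} (ha : 0 ≤ a) (hr : -1 < r) :
    ∫⁻ t in Set.Ioc 0 a, ENNReal.ofReal (t ^ r) = ENNReal.ofReal (a ^ (r + 1) / (r + 1)) := by
  rw [← ofReal_integral_eq_lintegral_ofReal]
  · rw [← intervalIntegral.integral_of_le ha, integral_rpow (Or.inl hr),
      Real.zero_rpow (by linarith), sub_zero]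
  · exact (intervalIntegrable_iff_integrableOn_Ioc_of_le ha).1
      (intervalIntegral.intervalIntegrable_rpow' hr)
  · exact (ae_restrict_iff' measurableSet_Ioc).2 (.of_forall fun t ht => Real.rpow_nonneg ht.1.le _)

theorem setLIntegral_Ioi_rpow {a r : ℝ} (ha : 0 < a) (hr : r < -1) :
    ∫⁻ t in Set.Ioi a, ENNReal.ofReal (t ^ r) = ENNReal.ofReal (a ^ (r + 1) / -(r + 1)) := by
  rw [← ofReal_integral_eq_lintegral_ofReal (integrableOn_Ioi_rpow_of_lt hr ha)]
  · rw [integral_Ioi_rpow_of_lt hr ha]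
    congr 1
    rw [div_neg, neg_div]
  · exact (ae_restrict_iff' measurableSet_Ioi).2
      (.of_forall fun t ht => Real.rpow_nonneg (ha.trans ht).le _)

/-- **Minkowski's integral inequality** for functions with values in `ℝ≥0∞`. -/
theorem lintegral_lintegral_rpow_le {α β : Type*} [MeasurableSpace α] [MeasurableSpace β]
    {μ : Measure α} {ν : Measure β} [SFinite μ] [SigmaFinite ν] {F : α → β → ℝ≥0∞}
    (hF : Measurable (Function.uncurry F)) {r : ℝ} (hr : 1 ≤ r) :
    (∫⁻ u, (∫⁻ x, F x u ∂μ) ^ r ∂ν) ^ (1 / r) ≤ ∫⁻ x, (∫⁻ u, F x u ^ r ∂ν) ^ (1 / r) ∂μ := by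
  have hr0 : 0 < r := by linarith
  rcases hr.eq_or_lt with rfl | hr1
  · simp only [ENNReal.rpow_one, div_one]
    rw [lintegral_lintegral_swap hF.aemeasurable]
  set G : β → ℝ≥0∞ := fun u => ∫⁻ x, F x u ∂μ with hGdef
  have hG : Measurable G := hF.lintegral_prod_left'
  set R := ∫⁻ x, (∫⁻ u, F x u ^ r ∂ν) ^ (1 / r) ∂μ with hR
  -- Truncating `G` in height and to sets of finite measure makes the integral `I` below finite, so
  -- that a power of it can be cancelled. Monotone convergence removes the truncation at the end.
  let H : ℕ → β → ℝ≥0∞ := fun k => (spanningSets ν k).indicator fun u => min (G u) k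
  have hH : ∀ k, Measurable (H k) := fun k =>
    (hG.min measurable_const).indicator (measurableSet_spanningSets ν k)
  have hHG : ∀ k u, H k u ≤ G u := fun k u =>
    Set.indicator_apply_le' (fun _ => min_le_left _ _) fun _ => zero_le
  have hconj : r.HolderConjugate (r / (r - 1)) := by
    simpa [Real.conjExponent] using Real.HolderConjugate.conjExponent hr1
  have key : ∀ k, (∫⁻ u, H k u ^ r ∂ν) ^ (1 / r) ≤ R := by
    intro k
    set I := ∫⁻ u, H k u ^ r ∂ν with hI
    have hItop : I ≠ ∞ := by
      have : I ≤ ∫⁻ u, (spanningSets ν k).indicator (fun _ => (k : ℝ≥0∞) ^ r) u ∂ν := by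
        refine lintegral_mono fun u => ?_
        by_cases hu : u ∈ spanningSets ν k
        · simp only [H, Set.indicator_of_mem hu]
          exact ENNReal.rpow_le_rpow (min_le_right _ _) hr0.le
        · simp [H, Set.indicator_of_notMem hu, hr0]
      refine ne_top_of_le_ne_top ?_ this
      rw [lintegral_indicator (measurableSet_spanningSets ν k), setLIntegral_const]
      exact ENNReal.mul_ne_top (by simp [hr0.le]) (measure_spanningSets_lt_top ν k).ne
    rcases eq_or_ne I 0 with h0 | h0
    · rw [h0, ENNReal.zero_rpow_of_pos (by positivity)]
      exact zero_le
    -- The usual duality argument: write `H^r ≤ H^{r-1} G`, exchange the integrals, and apply Hölder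
    -- in `u` for each fixed `x`.
    have h1 : I ≤ R * I ^ (1 / (r / (r - 1))) := by
      calc I ≤ ∫⁻ u, ∫⁻ x, H k u ^ (r - 1) * F x u ∂μ ∂ν := by
            refine lintegral_mono fun u => ?_
            rw [lintegral_const_mul' _ _]
            · calc H k u ^ r = H k u ^ (r - 1) * H k u := by
                    conv_rhs => rw [← ENNReal.rpow_one (H k u), ← ENNReal.rpow_mul,
                      ← ENNReal.rpow_add_of_nonneg _ _ (by linarith) (by norm_num)]
                    congr 1; ring
                _ ≤ _ := by gcongr; exact hHG k u
            · refine (ENNReal.rpow_lt_top_of_nonneg (by linarith) ?_).ne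
              by_cases hu : u ∈ spanningSets ν k
              · simp only [H, Set.indicator_of_mem hu]
                exact ne_top_of_le_ne_top (ENNReal.natCast_ne_top k) (min_le_right _ _)
              · simp [H, Set.indicator_of_notMem hu]
        _ = ∫⁻ x, ∫⁻ u, F x u * H k u ^ (r - 1) ∂ν ∂μ := by
            rw [lintegral_lintegral_swap]
            · simp_rw [mul_comm]
            · exact ((((hH k).comp measurable_fst).pow_const _).mul
                (hF.comp measurable_swap)).aemeasurable
        _ ≤ ∫⁻ x, (∫⁻ u, F x u ^ r ∂ν) ^ (1 / r) * I ^ (1 / (r / (r - 1))) ∂μ := by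
            refine lintegral_mono fun x => ?_
            refine (ENNReal.lintegral_mul_le_Lp_mul_Lq ν hconj
              (hF.comp measurable_prodMk_left).aemeasurable
              ((hH k).pow_const _).aemeasurable).trans (le_of_eq ?_)
            congr 2
            refine lintegral_congr fun u => ?_
            rw [← ENNReal.rpow_mul]
            congr 1
            have : r - 1 ≠ 0 := by linarith
            field_simp
        _ = _ := by
            rw [lintegral_mul_const' _ _ (ENNReal.rpow_lt_top_of_nonneg (by
              have : 0 < r - 1 := by linarith
              positivity) hItop).ne]
    have h2 : I = I ^ (1 / r) * I ^ (1 / (r / (r - 1))) := by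
      rw [← ENNReal.rpow_add _ _ h0 hItop]
      conv_lhs => rw [← ENNReal.rpow_one I]
      congr 1
      have : r - 1 ≠ 0 := by linarith
      field_simp
      ring
    have h3 : I ^ (1 / (r / (r - 1))) ≠ 0 := by simp [ENNReal.rpow_eq_zero_iff, h0, hItop]
    have h4 : I ^ (1 / (r / (r - 1))) ≠ ∞ := by simp [ENNReal.rpow_eq_top_iff, h0, hItop]
    exact (ENNReal.mul_le_mul_iff_left h3 h4).1 (h2.symm.le.trans h1)
  have hsup : ∀ u, ⨆ k, H k u ^ r = G u ^ r := by
    intro u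
    refine le_antisymm (iSup_le fun k => ENNReal.rpow_le_rpow (hHG k u) hr0.le) ?_
    have hlim : Filter.Tendsto (fun k => H k u) Filter.atTop (nhds (G u)) := by
      have h1 : Filter.Tendsto (fun k : ℕ => min (G u) (k : ℝ≥0∞)) Filter.atTop (nhds (G u)) := by
        simpa using (tendsto_const_nhds (x := G u)).min ENNReal.tendsto_nat_nhds_top
      refine h1.congr' ?_
      have hu : u ∈ ⋃ k, spanningSets ν k := by rw [iUnion_spanningSets]; trivial
      obtain ⟨k₀, hk₀⟩ := Set.mem_iUnion.1 hu
      filter_upwards [Filter.eventually_ge_atTop k₀] with k hk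
      simp only [H, Set.indicator_of_mem (monotone_spanningSets ν hk hk₀)]
    exact le_of_tendsto' ((ENNReal.continuous_rpow_const (y := r)).tendsto _ |>.comp hlim)
      fun k => le_iSup (fun k => H k u ^ r) k
  have hmono : Monotone fun k u => H k u ^ r := by
    intro k l hkl u
    refine ENNReal.rpow_le_rpow ?_ hr0.le
    by_cases hu : u ∈ spanningSets ν k
    · simp only [H, Set.indicator_of_mem hu, Set.indicator_of_mem (monotone_spanningSets ν hkl hu)]
      exact min_le_min_left _ (by exact_mod_cast hkl)
    · simp [H, Set.indicator_of_notMem hu]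
  have hG' : ∫⁻ u, G u ^ r ∂ν = ⨆ k, ∫⁻ u, H k u ^ r ∂ν := by
    rw [← lintegral_iSup (fun k => (hH k).pow_const _) hmono]
    exact lintegral_congr fun u => (hsup u).symm
  rw [hG', one_div, ENNReal.rpow_inv_le_iff hr0]
  refine iSup_le fun k => ?_
  rw [← ENNReal.rpow_inv_le_iff hr0, ← one_div]
  exact key k

/-- Splitting `g` along `A` bounds one piece trivially in `L¹` and leaves the transform of the other
for Plancherel. Both Paley and Hausdorff–Young use it with a set cut out by the size of `g`. -/
theorem enorm_fourier_le_setLIntegral_add {g : ℝ → ℂ} (hg : Integrable g) {A : Set ℝ} (hA : MeasurableSet A) (u : ℝ) :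
    ‖𝓕 g u‖ₑ ≤ (∫⁻ x in A, ‖g x‖ₑ) + ‖𝓕 (Aᶜ.indicator g) u‖ₑ := by
  have h : 𝓕 g u = 𝓕 (A.indicator g) u + 𝓕 (Aᶜ.indicator g) u := by
    have := VectorFourier.fourierIntegral_add (L := innerₗ ℝ) (μ := volume)
      Real.continuous_fourierChar continuous_inner (hg.indicator hA) (hg.indicator hA.compl)
    rw [Set.indicator_self_add_compl] at this
    exact congr_fun this u
  rw [h]
  refine (enorm_add_le _ _).trans ?_
  gcongr
  refine (enorm_fourier_le_lintegral _ u).trans (le_of_eq ?_)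
  rw [← lintegral_indicator hA]
  exact lintegral_congr fun x => by rw [enorm_indicator_eq_indicator_enorm]

theorem lintegral_enorm_fourier_indicator_sq {g : ℝ → ℂ} (hg : Integrable g)
    (hg2 : MemLp g 2) {A : Set ℝ} (hA : MeasurableSet A) :
    ∫⁻ u, ‖𝓕 (A.indicator g) u‖ₑ ^ 2 = ∫⁻ x in A, ‖g x‖ₑ ^ 2 := by
  rw [lintegral_enorm_fourier_sq (hg.indicator hA) (hg2.indicator hA), ← lintegral_indicator hA]
  refine lintegral_congr fun x => ?_
  by_cases hx : x ∈ A <;> simp [hx]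

theorem continuous_fourier_of_integrable {g : ℝ → ℂ} (hg : Integrable g) : Continuous (𝓕 g) :=
  VectorFourier.fourierIntegral_continuous Real.continuous_fourierChar
    (by exact continuous_inner) hg

/-- A form of the Marcinkiewicz interpolation argument between the exponents `1` and `2`. -/
theorem lintegral_rpow_le_of_weak_type {α β : Type*} [MeasurableSpace α] [MeasurableSpace β]
    {μ : Measure β} {ν : Measure α} [SFinite ν] {p : ℝ} (hp1 : 1 < p) (hp2 : p < 2)
    {h : β → ℝ} (hh0 : ∀ y, 0 ≤ h y) (hh : Measurable h) {G : α → ℝ} (hG0 : ∀ x, 0 ≤ G x)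
    (hG : Measurable G) (A : ℝ≥0∞)
    (hweak : ∀ t : ℝ, 0 < t → μ {y | t < h y} ≤
      A * (ENNReal.ofReal (t ^ (-1 : ℝ)) * ∫⁻ x in {x | t < G x}, ENNReal.ofReal (G x) ∂ν) +
      A * (ENNReal.ofReal (t ^ (-2 : ℝ)) * ∫⁻ x in {x | t < G x}ᶜ, ENNReal.ofReal (G x ^ 2) ∂ν)) :
    ∫⁻ y, ENNReal.ofReal (h y ^ p) ∂μ ≤
      ENNReal.ofReal p * (A * (ENNReal.ofReal (1 / (p - 1)) + ENNReal.ofReal (1 / (2 - p)))) *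
        ∫⁻ x, ENNReal.ofReal (G x ^ p) ∂ν := by
  have hp0 : 0 < p := by linarith
  have hS : MeasurableSet {z : ℝ × α | z.1 < G z.2} :=
    measurableSet_lt measurable_fst (hG.comp measurable_snd)
  rw [lintegral_rpow_eq_lintegral_meas_lt_mul μ (.of_forall hh0) hh.aemeasurable hp0, mul_assoc]
  gcongr
  -- The weak-type bound is multiplied by `t^{p-1}` and integrated in `t`. After the exchange of
  -- integrals, the `L¹` part meets `∫_0^G t^{p-2} dt = G^{p-1}/(p-1)`, which needs `p > 1`.
  have step1 : ∫⁻ t in Set.Ioi (0 : ℝ), ∫⁻ x, {z : ℝ × α | z.1 < G z.2}.indicator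
      (fun z => ENNReal.ofReal (z.1 ^ (p - 2)) * ENNReal.ofReal (G z.2)) (t, x) ∂ν ≤
      ENNReal.ofReal (1 / (p - 1)) * ∫⁻ x, ENNReal.ofReal (G x ^ p) ∂ν := by
    rw [lintegral_lintegral_swap, ← lintegral_const_mul _ (by fun_prop)]
    · refine lintegral_mono fun x => ?_
      have : ∀ t ∈ Set.Ioi (0 : ℝ), {z : ℝ × α | z.1 < G z.2}.indicator
          (fun z => ENNReal.ofReal (z.1 ^ (p - 2)) * ENNReal.ofReal (G z.2)) (t, x) ≤
          (Set.Ioc 0 (G x)).indicator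
            (fun t => ENNReal.ofReal (t ^ (p - 2)) * ENNReal.ofReal (G x)) t := by
        intro t ht
        by_cases hx : t < G x
        · rw [Set.indicator_of_mem (by exact hx), Set.indicator_of_mem (show t ∈ Set.Ioc 0 (G x) from ⟨ht, hx.le⟩)]
        · rw [Set.indicator_of_notMem (by exact hx)]; exact zero_le
      refine (setLIntegral_mono' measurableSet_Ioi this).trans ?_
      refine (setLIntegral_le_lintegral _ _).trans ?_
      rw [lintegral_indicator measurableSet_Ioc, lintegral_mul_const _ (by fun_prop),
        setLIntegral_Ioc_rpow (hG0 x) (by linarith), ← ENNReal.ofReal_mul' (hG0 x),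
        ← ENNReal.ofReal_mul (by have : 0 < p - 1 := by linarith
                                 positivity)]
      refine ENNReal.ofReal_le_ofReal (le_of_eq ?_)
      have : G x ^ p = G x ^ (p - 2 + 1) * G x := by
        rw [← Real.rpow_add_one' (hG0 x) (by linarith)]
        congr 1; ring
      rw [this]
      have h2 : p - 2 + 1 = p - 1 := by ring
      rw [h2]
      ring
    · exact Measurable.aemeasurable (Measurable.indicator (by fun_prop) hS)
  -- The `L²` part meets `∫_G^∞ t^{p-3} dt = G^{p-2}/(2-p)`, which needs `p < 2`. Where `G = 0` this
  -- integral diverges, but the factor `G²` vanishes.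
  have step2 : ∫⁻ t in Set.Ioi (0 : ℝ), ∫⁻ x, {z : ℝ × α | z.1 < G z.2}ᶜ.indicator
      (fun z => ENNReal.ofReal (z.1 ^ (p - 3)) * ENNReal.ofReal (G z.2 ^ 2)) (t, x) ∂ν ≤
      ENNReal.ofReal (1 / (2 - p)) * ∫⁻ x, ENNReal.ofReal (G x ^ p) ∂ν := by
    rw [lintegral_lintegral_swap, ← lintegral_const_mul _ (by fun_prop)]
    · refine lintegral_mono fun x => ?_
      rcases (hG0 x).eq_or_lt with h0 | h0
      · have : ∀ t : ℝ, {z : ℝ × α | z.1 < G z.2}ᶜ.indicator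
          (fun z => ENNReal.ofReal (z.1 ^ (p - 3)) * ENNReal.ofReal (G z.2 ^ 2)) (t, x) = 0 := by
          intro t
          rw [Set.indicator_apply_eq_zero]
          intro _
          simp [← h0]
        simp [this]
      have : ∀ t ∈ Set.Ioi (0 : ℝ), {z : ℝ × α | z.1 < G z.2}ᶜ.indicator
          (fun z => ENNReal.ofReal (z.1 ^ (p - 3)) * ENNReal.ofReal (G z.2 ^ 2)) (t, x) ≤
          (Set.Ici (G x)).indicator
            (fun t => ENNReal.ofReal (t ^ (p - 3)) * ENNReal.ofReal (G x ^ 2)) t := by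
        intro t ht
        by_cases hx : t < G x
        · rw [Set.indicator_of_notMem (by simpa using hx)]; exact zero_le
        · rw [Set.indicator_of_mem (by exact hx), Set.indicator_of_mem (by simpa using hx)]
      refine (setLIntegral_mono' measurableSet_Ioi this).trans ?_
      refine (setLIntegral_le_lintegral _ _).trans ?_
      rw [lintegral_indicator measurableSet_Ici, lintegral_mul_const _ (by fun_prop),
        setLIntegral_congr Ioi_ae_eq_Ici.symm,
        setLIntegral_Ioi_rpow h0 (by linarith), ← ENNReal.ofReal_mul' (by positivity),
        ← ENNReal.ofReal_mul (by have : 0 < 2 - p := by linarith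
                                 positivity)]
      refine ENNReal.ofReal_le_ofReal (le_of_eq ?_)
      have h3 : G x ^ p = G x ^ (p - 3 + 1) * G x ^ 2 := by
        rw [← Real.rpow_natCast, ← Real.rpow_add h0]
        congr 1; push_cast; ring
      rw [h3]
      have h2 : -(p - 3 + 1) = 2 - p := by ring
      rw [h2]
      ring
    · exact Measurable.aemeasurable (Measurable.indicator (by fun_prop) hS.compl)
  rw [mul_assoc, add_mul]
  refine le_trans ?_ (mul_le_mul_right (add_le_add step1 step2) A)
  rw [← lintegral_add_left, ← lintegral_const_mul]
  · refine setLIntegral_mono' measurableSet_Ioi fun t ht => ?_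
    have ht : 0 < t := ht
    refine (mul_le_mul_left (hweak t ht) _).trans (le_of_eq ?_)
    have hSt : MeasurableSet {x | t < G x} := measurableSet_lt measurable_const hG
    have e1 : ∫⁻ x, {z : ℝ × α | z.1 < G z.2}.indicator
        (fun z => ENNReal.ofReal (z.1 ^ (p - 2)) * ENNReal.ofReal (G z.2)) (t, x) ∂ν =
        ENNReal.ofReal (t ^ (p - 2)) * ∫⁻ x in {x | t < G x}, ENNReal.ofReal (G x) ∂ν := by
      rw [← lintegral_const_mul _ (by fun_prop), ← lintegral_indicator hSt]
      rfl
    have e2 : ∫⁻ x, {z : ℝ × α | z.1 < G z.2}ᶜ.indicator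
        (fun z => ENNReal.ofReal (z.1 ^ (p - 3)) * ENNReal.ofReal (G z.2 ^ 2)) (t, x) ∂ν =
        ENNReal.ofReal (t ^ (p - 3)) * ∫⁻ x in {x | t < G x}ᶜ, ENNReal.ofReal (G x ^ 2) ∂ν := by
      rw [← lintegral_const_mul _ (by fun_prop), ← lintegral_indicator hSt.compl]
      rfl
    rw [e1, e2]
    have e3 : ENNReal.ofReal (t ^ (p - 2)) =
        ENNReal.ofReal (t ^ (-1 : ℝ)) * ENNReal.ofReal (t ^ (p - 1)) := by
      rw [← ENNReal.ofReal_mul (by positivity), ← Real.rpow_add ht]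
      congr 2; ring
    have e4 : ENNReal.ofReal (t ^ (p - 3)) =
        ENNReal.ofReal (t ^ (-2 : ℝ)) * ENNReal.ofReal (t ^ (p - 1)) := by
      rw [← ENNReal.ofReal_mul (by positivity), ← Real.rpow_add ht]
      congr 2; ring
    rw [e3, e4]
    ring
  · exact (Measurable.lintegral_prod_right' (Measurable.indicator (by fun_prop) hS)).add
      (Measurable.lintegral_prod_right' (Measurable.indicator (by fun_prop) hS.compl))
  · exact Measurable.lintegral_prod_right' (Measurable.indicator (by fun_prop) hS)

/-- **Paley's inequality** for the Fourier transform on the line. -/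
theorem exists_lintegral_fourier_rpow_mul_le {p : ℝ} (hp1 : 1 < p) (hp2 : p < 2) :
    ∃ C : ℝ≥0, ∀ g : ℝ → ℂ, Measurable g → Integrable g → MemLp g 2 →
      ∫⁻ u in Set.Ioi (0 : ℝ), ‖𝓕 g u‖ₑ ^ p * ENNReal.ofReal (u ^ (p - 2)) ≤
        C * ∫⁻ x, ‖g x‖ₑ ^ p := by
  have hp0 : 0 < p := by linarith
  refine ⟨(ENNReal.ofReal p *
    (4 * (ENNReal.ofReal (1 / (p - 1)) + ENNReal.ofReal (1 / (2 - p))))).toNNReal,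
    fun g hgm hg hg2 => ?_⟩
  rw [ENNReal.coe_toNNReal (by finiteness)]
  have hFm : Measurable (𝓕 g) := (continuous_fourier_of_integrable hg).measurable
  -- The operator `g ↦ u ĝ(u)` is of weak type `(1,1)` for `u^{-2} du`, since `u |ĝ(u)| > t` forces
  -- `u > t/‖g‖₁`. It is bounded on `L²` by Plancherel, because the weight cancels `u²`.
  set μ : Measure ℝ := (volume.restrict (Set.Ioi 0)).withDensity
    fun u => ENNReal.ofReal (u ^ (-2 : ℝ)) with hμ
  have hμm : Measurable fun u : ℝ => ENNReal.ofReal (u ^ (-2 : ℝ)) := by fun_prop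
  have main := lintegral_rpow_le_of_weak_type (μ := μ) (ν := volume) hp1 hp2
    (h := fun u => |u| * ‖𝓕 g u‖) (fun u => by positivity) (by fun_prop)
    (G := fun x => ‖g x‖) (fun x => norm_nonneg _) hgm.norm 4 ?_
  · have e1 : ∀ x, ENNReal.ofReal (‖g x‖ ^ p) = ‖g x‖ₑ ^ p := fun x => by
      rw [← ofReal_norm, ENNReal.ofReal_rpow_of_nonneg (norm_nonneg _) hp0.le]
    simp_rw [e1] at main
    refine le_trans (le_of_eq ?_) main
    rw [hμ, lintegral_withDensity_eq_lintegral_mul _ hμm (by fun_prop)]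
    refine setLIntegral_congr_fun measurableSet_Ioi fun u hu => ?_
    have hu : 0 < u := hu
    simp only [Pi.mul_apply, ← ofReal_norm]
    rw [ENNReal.ofReal_rpow_of_nonneg (norm_nonneg _) hp0.le, ← ENNReal.ofReal_mul (by positivity),
      ← ENNReal.ofReal_mul (by positivity), Real.mul_rpow (by positivity) (by positivity),
      abs_of_pos hu, ← mul_assoc, ← Real.rpow_add hu, mul_comm]
    congr 3
    ring
  intro t ht
  set A := {x | t < ‖g x‖} with hA
  have hAm : MeasurableSet A := measurableSet_lt measurable_const hgm.norm
  set m := ∫ x in A, ‖g x‖ with hm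
  have hm0 : 0 ≤ m := integral_nonneg fun _ => norm_nonneg _
  have hmI : ∫⁻ x in A, ‖g x‖ₑ = ENNReal.ofReal m := by
    rw [hm, ofReal_integral_eq_lintegral_ofReal hg.norm.integrableOn
      (.of_forall fun _ => norm_nonneg _)]
    simp
  -- If `u |ĝ(u)|` exceeds `t`, one of the two pieces of `g` contributes at least `t/2`. The factor
  -- `4` supplied above is `(1/2)^{-2}` from the `L²` piece; the `L¹` piece costs only `2`.
  have hsub : {u | t < |u| * ‖𝓕 g u‖} ⊆ {u | t / 2 < |u| * m} ∪
      {u | t / 2 ≤ |u| * ‖𝓕 (Aᶜ.indicator g) u‖} := by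
    intro u hu
    by_contra hcon
    simp only [Set.mem_union, Set.mem_ofPred_eq, not_or, not_lt, not_le] at hcon hu
    have h1 := enorm_fourier_le_setLIntegral_add hg hAm u
    rw [hmI, ← ofReal_norm, ← ofReal_norm, ← ENNReal.ofReal_add hm0 (norm_nonneg _),
      ENNReal.ofReal_le_ofReal_iff (by positivity)] at h1
    have := mul_le_mul_of_nonneg_left h1 (abs_nonneg u)
    rw [mul_add] at this
    linarith
  refine (measure_mono hsub).trans ((measure_union_le _ _).trans (add_le_add ?_ ?_))
  · have : ∫⁻ x in A, ENNReal.ofReal ‖g x‖ = ENNReal.ofReal m := by simpa using hmI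
    rw [this, Real.rpow_neg_one]
    rcases hm0.eq_or_lt with h0 | h0
    · have : {u : ℝ | t / 2 < |u| * m} = ∅ := by
        ext u
        simp [← h0]
        linarith
      rw [this]; simp
    rw [hμ, withDensity_apply _ (measurableSet_lt measurable_const (by fun_prop)),
      Measure.restrict_restrict (measurableSet_lt measurable_const (by fun_prop))]
    have hset : {u : ℝ | t / 2 < |u| * m} ∩ Set.Ioi 0 ⊆ Set.Ioi (t / (2 * m)) := by
      rintro u ⟨hu, hu0⟩
      have hu0 : 0 < u := hu0
      simp only [Set.mem_ofPred_eq, abs_of_pos hu0, Set.mem_Ioi] at hu ⊢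
      rw [div_lt_iff₀ (by positivity)]
      linarith
    refine (lintegral_mono_set hset).trans ?_
    rw [setLIntegral_Ioi_rpow (by positivity) (by norm_num),
      ← ENNReal.ofReal_mul (by positivity), ← ENNReal.ofReal_ofNat,
      ← ENNReal.ofReal_mul (by norm_num)]
    refine ENNReal.ofReal_le_ofReal ?_
    have : (-2 : ℝ) + 1 = -1 := by norm_num
    rw [this, Real.rpow_neg_one, neg_neg, div_one, inv_div]
    have : 0 ≤ t⁻¹ * m := by positivity
    calc 2 * m / t = 2 * (t⁻¹ * m) := by field_simp
      _ ≤ _ := by linarith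
  · have hg2m : Measurable (𝓕 (Aᶜ.indicator g)) :=
      (continuous_fourier_of_integrable (hg.indicator hAm.compl)).measurable
    set E := {u : ℝ | t / 2 ≤ |u| * ‖𝓕 (Aᶜ.indicator g) u‖} with hE
    have hEm : MeasurableSet E := measurableSet_le measurable_const (by fun_prop)
    have e1 : ∀ x, ENNReal.ofReal (‖g x‖ ^ 2) = ‖g x‖ₑ ^ 2 := fun x => by
      rw [← ofReal_norm, ENNReal.ofReal_pow (norm_nonneg _)]
    simp_rw [e1]
    rw [← lintegral_enorm_fourier_indicator_sq hg hg2 hAm.compl,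
      hμ, withDensity_apply _ hEm, ← mul_assoc, ← lintegral_const_mul _ (by fun_prop),
      Measure.restrict_restrict hEm]
    refine le_trans ?_ (setLIntegral_le_lintegral (E ∩ Set.Ioi 0) _)
    refine setLIntegral_mono' (hEm.inter measurableSet_Ioi) fun u hu => ?_
    have hu0 : 0 < u := hu.2
    have huE : t / 2 ≤ u * ‖𝓕 (Aᶜ.indicator g) u‖ := by simpa [hE, abs_of_pos hu0] using hu.1
    rw [← ofReal_norm, ← ENNReal.ofReal_pow (norm_nonneg _), ← ENNReal.ofReal_ofNat,
      ← ENNReal.ofReal_mul (by norm_num), ← ENNReal.ofReal_mul (by positivity)]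
    refine ENNReal.ofReal_le_ofReal ?_
    rw [Real.rpow_neg hu0.le, Real.rpow_neg ht.le, Real.rpow_two, Real.rpow_two]
    have : (t / 2) ^ 2 ≤ (u * ‖𝓕 (Aᶜ.indicator g) u‖) ^ 2 := by gcongr
    rw [inv_le_iff_one_le_mul₀ (by positivity)]
    calc (1 : ℝ) = 4 * (t ^ 2)⁻¹ * (t / 2) ^ 2 := by field_simp; norm_num
      _ ≤ 4 * (t ^ 2)⁻¹ * (u * ‖𝓕 (Aᶜ.indicator g) u‖) ^ 2 := by gcongr
      _ = _ := by ring

/-- The **Hausdorff–Young inequality** on the line, up to a constant. -/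
theorem exists_lintegral_fourier_rpow_conj_le {p r : ℝ} (hpr : p.HolderConjugate r) (hp2 : p < 2) :
    ∃ C : ℝ≥0, ∀ g : ℝ → ℂ, Measurable g → Integrable g → MemLp g 2 →
      ∫⁻ u, ‖𝓕 g u‖ₑ ^ r ≤ C * (∫⁻ x, ‖g x‖ₑ ^ p) ^ (r / p) := by
  have hp0 : 0 < p := hpr.pos
  have hp1 : 1 < p := hpr.lt
  have hr0 : 0 < r := hpr.symm.pos
  have hmul := hpr.mul_eq_add
  have hr2 : 2 < r := by nlinarith
  refine ⟨(ENNReal.ofReal r * (4 * ENNReal.ofReal (2 ^ (r - 2) / (r - 2)))).toNNReal,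
    fun g hgm hg hg2 => ?_⟩
  rw [ENNReal.coe_toNNReal (by finiteness)]
  have hFm : Measurable (𝓕 g) := (continuous_fourier_of_integrable hg).measurable
  set M' := ∫⁻ x, ‖g x‖ₑ ^ p with hM'
  rcases eq_or_ne M' 0 with h0 | h0
  · have : ∀ᵐ x, g x = 0 := by
      filter_upwards [(lintegral_eq_zero_iff (by fun_prop)).1 h0] with x hx
      simpa [hp0, hp0.le, hp0.not_gt] using hx
    have h1 : ∫⁻ x, ‖g x‖ₑ = 0 := by
      rw [lintegral_eq_zero_iff (by fun_prop)]
      filter_upwards [this] with x hx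
      simp [hx]
    have h2 : ∀ u, ‖𝓕 g u‖ₑ = 0 := fun u => by
      have := enorm_fourier_le_lintegral g u
      rwa [h1, nonpos_iff_eq_zero] at this
    simp [h2, hr0]
  rcases eq_or_ne M' ∞ with hT | hT
  · rw [hT, ENNReal.top_rpow_of_pos (by positivity), ENNReal.mul_top]
    · exact le_top
    · have : 0 < r - 2 := by linarith
      simp only [ne_eq, mul_eq_zero, ENNReal.ofReal_eq_zero, not_or, not_le]
      exact ⟨hr0, by norm_num, by positivity⟩
  set M := M'.toReal with hM
  have hM0 : 0 < M := ENNReal.toReal_pos h0 hT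
  have hMM : M' = ENNReal.ofReal M := (ENNReal.ofReal_toReal hT).symm
  have e0 : ∀ u, ‖𝓕 g u‖ₑ ^ r = ENNReal.ofReal (‖𝓕 g u‖ ^ r) := fun u => by
    rw [← ofReal_norm, ENNReal.ofReal_rpow_of_nonneg (norm_nonneg _) hr0.le]
  simp_rw [e0]
  rw [lintegral_rpow_eq_lintegral_meas_lt_mul volume (.of_forall fun _ => norm_nonneg _)
    hFm.norm.aemeasurable hr0, mul_assoc]
  gcongr
  set S : Set (ℝ × ℝ) := {z | ‖g z.2‖ ^ (p - 1) * z.1 ≤ 2 * M} with hSdef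
  have hS : MeasurableSet S := measurableSet_le (by fun_prop) measurable_const
  have hpt : ∀ t ∈ Set.Ioi (0 : ℝ), volume {u | t < ‖𝓕 g u‖} * ENNReal.ofReal (t ^ (r - 1)) ≤
      4 * ∫⁻ x, S.indicator (fun z => ENNReal.ofReal (z.1 ^ (r - 3)) * ‖g z.2‖ₑ ^ 2) (t, x) := by
    intro t ht
    have ht : 0 < t := ht
    -- The cut depends on `t` through `M = ∫ |g|^p`. Off `B` one has `|g| ≤ (t/2M) |g|^p`, so that
    -- piece has `L¹` norm at most `t/2` and cannot by itself reach the level `t`. Only the `L²`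
    -- bound on `B` is then needed.
    set B : Set ℝ := {x | ‖g x‖ ^ (p - 1) * t ≤ 2 * M} with hB
    have hBm : MeasurableSet B := measurableSet_le (by fun_prop) measurable_const
    have hlow : ∫⁻ x in Bᶜ, ‖g x‖ₑ ≤ ENNReal.ofReal (t / 2) := by
      calc ∫⁻ x in Bᶜ, ‖g x‖ₑ ≤ ∫⁻ x in Bᶜ, ENNReal.ofReal (t / (2 * M)) * ‖g x‖ₑ ^ p := by
            refine setLIntegral_mono' hBm.compl fun x hx => ?_
            have hx : 2 * M < ‖g x‖ ^ (p - 1) * t := by simpa [hB] using hx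
            rw [← ofReal_norm, ENNReal.ofReal_rpow_of_nonneg (norm_nonneg _) hp0.le,
              ← ENNReal.ofReal_mul (by positivity)]
            refine ENNReal.ofReal_le_ofReal ?_
            have e : ‖g x‖ ^ p = ‖g x‖ ^ (p - 1) * ‖g x‖ := by
              rw [← Real.rpow_add_one' (norm_nonneg _) (by linarith)]
              congr 1; ring
            rw [e]
            calc ‖g x‖ = 2 * M / (2 * M) * ‖g x‖ := by field_simp
              _ ≤ ‖g x‖ ^ (p - 1) * t / (2 * M) * ‖g x‖ := by gcongr
              _ = _ := by ring
        _ ≤ ∫⁻ x, ENNReal.ofReal (t / (2 * M)) * ‖g x‖ₑ ^ p := setLIntegral_le_lintegral _ _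
        _ = ENNReal.ofReal (t / 2) := by
            rw [lintegral_const_mul _ (by fun_prop), ← hM', hMM,
              ← ENNReal.ofReal_mul (by positivity)]
            congr 1
            field_simp
    have hsub : {u | t < ‖𝓕 g u‖} ⊆ {u | ENNReal.ofReal (t / 2) ^ 2 ≤
        ‖𝓕 (B.indicator g) u‖ₑ ^ 2} := by
      intro u hu
      have h1 := enorm_fourier_le_setLIntegral_add hg hBm.compl u
      rw [compl_compl] at h1
      have h2 := h1.trans (add_le_add_left hlow _)
      simp only [Set.mem_ofPred_eq] at hu ⊢
      refine pow_le_pow_left₀ zero_le ?_ 2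
      rw [← ofReal_norm, ← ofReal_norm, ← ENNReal.ofReal_add (by positivity) (norm_nonneg _),
        ENNReal.ofReal_le_ofReal_iff (by positivity)] at h2
      rw [← ofReal_norm]
      exact ENNReal.ofReal_le_ofReal (by linarith)
    have hmeas : Measurable fun u => ‖𝓕 (B.indicator g) u‖ₑ ^ 2 := by
      have := (continuous_fourier_of_integrable (hg.indicator hBm)).measurable
      fun_prop
    have hcheb := mul_meas_ge_le_lintegral (μ := volume) hmeas (ENNReal.ofReal (t / 2) ^ 2)
    rw [lintegral_enorm_fourier_indicator_sq hg hg2 hBm] at hcheb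
    have hind : ∫⁻ x, S.indicator (fun z => ENNReal.ofReal (z.1 ^ (r - 3)) * ‖g z.2‖ₑ ^ 2) (t, x) =
        ENNReal.ofReal (t ^ (r - 3)) * ∫⁻ x in B, ‖g x‖ₑ ^ 2 := by
      rw [← lintegral_const_mul _ (by fun_prop), ← lintegral_indicator hBm]
      rfl
    rw [hind, ← mul_assoc]
    have hsplit : ENNReal.ofReal (t ^ (r - 1)) =
        4 * ENNReal.ofReal (t ^ (r - 3)) * ENNReal.ofReal (t / 2) ^ 2 := by
      rw [← ENNReal.ofReal_pow (by positivity), ← ENNReal.ofReal_ofNat,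
        ← ENNReal.ofReal_mul (by norm_num), ← ENNReal.ofReal_mul (by positivity)]
      congr 1
      have : t ^ (r - 1) = t ^ (r - 3) * t ^ 2 := by
        rw [← Real.rpow_natCast, ← Real.rpow_add ht]
        congr 1; push_cast; ring
      rw [this]
      ring
    calc volume {u | t < ‖𝓕 g u‖} * ENNReal.ofReal (t ^ (r - 1))
        ≤ volume {u | ENNReal.ofReal (t / 2) ^ 2 ≤ ‖𝓕 (B.indicator g) u‖ₑ ^ 2} *
          ENNReal.ofReal (t ^ (r - 1)) := by gcongr
      _ = 4 * ENNReal.ofReal (t ^ (r - 3)) * (ENNReal.ofReal (t / 2) ^ 2 *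
          volume {u | ENNReal.ofReal (t / 2) ^ 2 ≤ ‖𝓕 (B.indicator g) u‖ₑ ^ 2}) := by
            rw [hsplit]; ring
      _ ≤ _ := by gcongr
  refine (setLIntegral_mono' measurableSet_Ioi hpt).trans ?_
  rw [lintegral_const_mul' _ _ (by norm_num), mul_assoc]
  gcongr
  rw [lintegral_lintegral_swap]
  swap
  · exact Measurable.aemeasurable (Measurable.indicator (by fun_prop) hS)
  have hinner : ∀ x, ∫⁻ t in Set.Ioi (0 : ℝ),
      S.indicator (fun z => ENNReal.ofReal (z.1 ^ (r - 3)) * ‖g z.2‖ₑ ^ 2) (t, x) ≤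
      ENNReal.ofReal (2 ^ (r - 2) / (r - 2)) * ENNReal.ofReal (M ^ (r - 2)) * ‖g x‖ₑ ^ p := by
    intro x
    rcases eq_or_ne (g x) 0 with hx | hx
    · have : ∀ t : ℝ, S.indicator (fun z => ENNReal.ofReal (z.1 ^ (r - 3)) * ‖g z.2‖ₑ ^ 2) (t, x)
          = 0 := fun t => by
        rw [Set.indicator_apply_eq_zero]
        intro _
        simp [hx]
      simp [this]
    have hgx : 0 < ‖g x‖ := norm_pos_iff.2 hx
    set a := 2 * M * ‖g x‖ ^ (1 - p) with ha
    have ha0 : 0 ≤ a := by positivity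
    have hle : ∀ t ∈ Set.Ioi (0 : ℝ),
        S.indicator (fun z => ENNReal.ofReal (z.1 ^ (r - 3)) * ‖g z.2‖ₑ ^ 2) (t, x) ≤
        (Set.Ioc 0 a).indicator (fun t => ENNReal.ofReal (t ^ (r - 3)) * ‖g x‖ₑ ^ 2) t := by
      intro t ht
      by_cases hmem : (t, x) ∈ S
      · rw [Set.indicator_of_mem hmem, Set.indicator_of_mem]
        refine ⟨ht, ?_⟩
        have h1 : ‖g x‖ ^ (p - 1) * t ≤ 2 * M := hmem
        have h2 : ‖g x‖ ^ (1 - p) * ‖g x‖ ^ (p - 1) = 1 := by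
          rw [← Real.rpow_add hgx]; simp
        calc t = ‖g x‖ ^ (1 - p) * (‖g x‖ ^ (p - 1) * t) := by rw [← mul_assoc, h2, one_mul]
          _ ≤ ‖g x‖ ^ (1 - p) * (2 * M) := by gcongr
          _ = a := by rw [ha]; ring
      · rw [Set.indicator_of_notMem hmem]; exact zero_le
    refine (setLIntegral_mono' measurableSet_Ioi hle).trans
      ((setLIntegral_le_lintegral _ _).trans ?_)
    rw [lintegral_indicator measurableSet_Ioc, lintegral_mul_const _ (by fun_prop),
      setLIntegral_Ioc_rpow ha0 (by linarith), ← ofReal_norm,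
      ENNReal.ofReal_rpow_of_nonneg (norm_nonneg _) hp0.le, ← ENNReal.ofReal_pow (norm_nonneg _)]
    have hr2' : 0 < r - 2 := by linarith
    have hr3 : r - 3 + 1 = r - 2 := by ring
    rw [hr3, ← ENNReal.ofReal_mul (by positivity), ← ENNReal.ofReal_mul (by positivity),
      ← ENNReal.ofReal_mul (by positivity)]
    refine ENNReal.ofReal_le_ofReal (le_of_eq ?_)
    -- The exponents match because `(1-p)(r-2) + 2 = p`, a form of `pr = p + r`.
    have h3 : ‖g x‖ ^ p = (‖g x‖ ^ (1 - p)) ^ (r - 2) * ‖g x‖ ^ 2 := by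
      rw [← Real.rpow_natCast, ← Real.rpow_mul hgx.le, ← Real.rpow_add hgx]
      congr 1; push_cast; linarith
    rw [h3, ha, Real.mul_rpow (by positivity) (by positivity),
      Real.mul_rpow (by norm_num) hM0.le]
    ring
  refine (lintegral_mono hinner).trans ?_
  rw [lintegral_const_mul _ (by fun_prop), ← hM', mul_assoc, hMM,
    ENNReal.ofReal_rpow_of_pos hM0, ← ENNReal.ofReal_mul (by positivity)]
  gcongr
  refine le_of_eq ?_
  rw [← Real.rpow_add_one hM0.ne']
  congr 1
  field_simp
  linarith

/-! ### Splitting off the last coordinate of a Euclidean space. -/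

section SnocPoint

variable {d : ℕ}

@[simp] theorem snocPoint_castSucc (ξ : EuclideanSpace ℝ (Fin d)) (s : ℝ) (i : Fin d) :
    snocPoint ξ s i.castSucc = ξ i := by
  simp [snocPoint]

@[simp] theorem snocPoint_last (ξ : EuclideanSpace ℝ (Fin d)) (s : ℝ) :
    snocPoint ξ s (Fin.last d) = s := by
  simp [snocPoint]

/-- The first `d` coordinates of a point of `ℝ^{d+1}`. -/
noncomputable def initPoint (w : EuclideanSpace ℝ (Fin (d + 1))) : EuclideanSpace ℝ (Fin d) :=
  WithLp.toLp 2 fun i => w i.castSucc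

@[simp] theorem initPoint_apply (w : EuclideanSpace ℝ (Fin (d + 1))) (i : Fin d) :
    initPoint w i = w i.castSucc := rfl

theorem ext_snocPoint {v w : EuclideanSpace ℝ (Fin (d + 1))} (h : ∀ i : Fin d,
    v i.castSucc = w i.castSucc) (hl : v (Fin.last d) = w (Fin.last d)) : v = w := by
  ext i
  exact Fin.lastCases hl h i

@[simp] theorem snocPoint_initPoint (w : EuclideanSpace ℝ (Fin (d + 1))) :
    snocPoint (initPoint w) (w (Fin.last d)) = w :=
  ext_snocPoint (by simp) (by simp)

@[simp] theorem initPoint_snocPoint (ξ : EuclideanSpace ℝ (Fin d)) (s : ℝ) :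
    initPoint (snocPoint ξ s) = ξ := by
  ext i; simp

theorem snocPoint_add (ξ η : EuclideanSpace ℝ (Fin d)) (s t : ℝ) :
    snocPoint (ξ + η) (s + t) = snocPoint ξ s + snocPoint η t :=
  ext_snocPoint (by simp) (by simp)

theorem snocPoint_smul (c : ℝ) (ξ : EuclideanSpace ℝ (Fin d)) (s : ℝ) :
    snocPoint (c • ξ) (c * s) = c • snocPoint ξ s :=
  ext_snocPoint (by simp) (by simp)

theorem inner_snocPoint (ξ η : EuclideanSpace ℝ (Fin d)) (s t : ℝ) :
    inner ℝ (snocPoint ξ s) (snocPoint η t) = inner ℝ ξ η + s * t := by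
  simp [PiLp.inner_apply, Fin.sum_univ_castSucc, mul_comm]

theorem norm_snocPoint_sq (ξ : EuclideanSpace ℝ (Fin d)) (s : ℝ) :
    ‖snocPoint ξ s‖ ^ 2 = ‖ξ‖ ^ 2 + s ^ 2 := by
  rw [← real_inner_self_eq_norm_sq, ← real_inner_self_eq_norm_sq, inner_snocPoint, sq]

@[fun_prop]
theorem Continuous.snocPoint {X : Type*} [TopologicalSpace X] {f : X → EuclideanSpace ℝ (Fin d)}
    {g : X → ℝ} (hf : Continuous f) (hg : Continuous g) :
    Continuous fun x => snocPoint (f x) (g x) := by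
  refine (PiLp.continuous_toLp 2 _).comp (continuous_pi fun i => ?_)
  refine Fin.lastCases ?_ (fun j => ?_) i
  · simpa using hg
  · simp only [Fin.snoc_castSucc]
    exact (PiLp.continuous_apply 2 _ j).comp hf

@[fun_prop]
theorem Measurable.snocPoint {X : Type*} [MeasurableSpace X] {f : X → EuclideanSpace ℝ (Fin d)}
    {g : X → ℝ} (hf : Measurable f) (hg : Measurable g) :
    Measurable fun x => snocPoint (f x) (g x) :=
  (show Continuous fun z : EuclideanSpace ℝ (Fin d) × ℝ => _root_.snocPoint z.1 z.2 by
    fun_prop).measurable.comp (hf.prodMk hg)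

@[fun_prop]
theorem continuous_initPoint : Continuous (initPoint (d := d)) :=
  (PiLp.continuous_toLp 2 _).comp (continuous_pi fun i => PiLp.continuous_apply 2 _ i.castSucc)

theorem measurePreserving_snocPoint :
    MeasurePreserving (fun z : EuclideanSpace ℝ (Fin d) × ℝ => snocPoint z.1 z.2)
      (volume.prod volume) volume := by
  have h1 := (volume_preserving_piFinSuccAbove (fun _ : Fin (d + 1) => ℝ) (Fin.last d)).symm
  have h2 : MeasurePreserving (fun z : EuclideanSpace ℝ (Fin d) × ℝ => (z.2, WithLp.ofLp z.1))
      (volume.prod volume) (volume.prod volume) :=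
    ((MeasurePreserving.id volume).prod (PiLp.volume_preserving_ofLp (Fin d))).comp
      Measure.measurePreserving_swap
  have h3 := (PiLp.volume_preserving_toLp (Fin (d + 1))).comp (h1.comp h2)
  convert! h3 using 1
  funext z
  refine ext_snocPoint (fun i => ?_) ?_
  · simp [MeasurableEquiv.piFinSuccAbove]
  · simp [MeasurableEquiv.piFinSuccAbove]

theorem lintegral_snocPoint {F : EuclideanSpace ℝ (Fin (d + 1)) → ℝ≥0∞} (hF : Measurable F) :
    ∫⁻ w, F w = ∫⁻ x, ∫⁻ t, F (snocPoint x t) := by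
  rw [← measurePreserving_snocPoint.lintegral_comp hF, lintegral_prod _ (by fun_prop)]

/-- The isometric embedding `ξ ↦ (ξ, 0)`. -/
noncomputable def snocZero (d : ℕ) : EuclideanSpace ℝ (Fin d) →ₗᵢ[ℝ] EuclideanSpace ℝ (Fin (d + 1)) where
  toFun ξ := snocPoint ξ 0
  map_add' ξ η := by rw [← snocPoint_add, add_zero]
  map_smul' c ξ := by rw [RingHom.id_apply, ← snocPoint_smul, mul_zero]
  norm_map' ξ := by
    rw [← sq_eq_sq₀ (norm_nonneg _) (norm_nonneg _)]
    change ‖snocPoint ξ 0‖ ^ 2 = _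
    rw [norm_snocPoint_sq]
    ring

theorem snocPoint_eq_snocZero_add (ξ : EuclideanSpace ℝ (Fin d)) (s : ℝ) :
    snocPoint ξ s = snocZero d ξ + snocPoint 0 s := by
  change _ = snocPoint ξ 0 + _
  rw [← snocPoint_add, add_zero, zero_add]

end SnocPoint

/-! ### The partial Fourier transform and its slices. -/

section Slices

variable {d : ℕ}

/-- The partial Fourier transform of `f` in its last variable. -/
noncomputable def partialFourier (f : EuclideanSpace ℝ (Fin (d + 1)) → ℂ) (u : ℝ)
    (x : EuclideanSpace ℝ (Fin d)) : ℂ :=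
  𝓕 (fun t => f (snocPoint x t)) u

/-- The factor `(1 + |t|)^{-2}` is an integrable majorant in the last variable, uniform in `x`; it
gives integrability on lines and the domination behind continuity of the partial transform. -/
theorem exists_norm_snocPoint_le (f : 𝓢(EuclideanSpace ℝ (Fin (d + 1)), ℂ)) (k : ℕ) :
    ∃ C : ℝ, 0 ≤ C ∧ ∀ x t, ‖f (snocPoint x t)‖ ≤
      C * ((1 + ‖x‖) ^ (-(k : ℝ)) * (1 + ‖t‖) ^ (-2 : ℝ)) := by
  set D := 2 ^ (k + 2) * ((Finset.Iic (k + 2, 0)).sup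
    fun m => SchwartzMap.seminorm ℝ m.1 m.2) f with hD
  refine ⟨D, by positivity, fun x t => ?_⟩
  have h := SchwartzMap.one_add_le_sup_seminorm_apply (𝕜 := ℝ) (m := (k + 2, 0)) le_rfl le_rfl f
    (snocPoint x t)
  rw [norm_iteratedFDeriv_zero, ← hD] at h
  have hx : ‖x‖ ≤ ‖snocPoint x t‖ := by
    rw [← sq_le_sq₀ (norm_nonneg _) (norm_nonneg _), norm_snocPoint_sq]
    nlinarith
  have ht : ‖t‖ ≤ ‖snocPoint x t‖ := by
    rw [← sq_le_sq₀ (norm_nonneg _) (norm_nonneg _), norm_snocPoint_sq, Real.norm_eq_abs, sq_abs]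
    nlinarith [sq_nonneg ‖x‖]
  have h2 : (1 + ‖x‖) ^ k * (1 + ‖t‖) ^ 2 * ‖f (snocPoint x t)‖ ≤ D := by
    refine le_trans ?_ h
    rw [pow_add]
    gcongr
  have e : (1 + ‖t‖) ^ (-2 : ℝ) = ((1 + ‖t‖) ^ 2)⁻¹ := by
    rw [Real.rpow_neg (by positivity), Real.rpow_two]
  rw [e, Real.rpow_neg (by positivity), Real.rpow_natCast, ← mul_inv, ← div_eq_mul_inv,
    le_div_iff₀ (by positivity)]
  linarith

theorem integrable_snocPoint_section (f : 𝓢(EuclideanSpace ℝ (Fin (d + 1)), ℂ))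
    (x : EuclideanSpace ℝ (Fin d)) : Integrable fun t => f (snocPoint x t) := by
  obtain ⟨C, -, hC⟩ := exists_norm_snocPoint_le f 0
  refine Integrable.mono' ((integrable_one_add_norm (E := ℝ) (r := 2) (by simp)).const_mul C)
    (Continuous.aestronglyMeasurable (by fun_prop)) (.of_forall fun t => ?_)
  simpa using hC x t

theorem memLp_two_snocPoint_section (f : 𝓢(EuclideanSpace ℝ (Fin (d + 1)), ℂ))
    (x : EuclideanSpace ℝ (Fin d)) : MemLp (fun t => f (snocPoint x t)) 2 := by
  refine (memLp_two_iff_integrable_sq_norm (integrable_snocPoint_section f x).1).2 ?_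
  refine ((integrable_snocPoint_section f x).norm.const_mul (SchwartzMap.seminorm ℝ 0 0 f)).mono'
    (Continuous.aestronglyMeasurable (by fun_prop)) (.of_forall fun t => ?_)
  rw [norm_pow, norm_norm, sq]
  gcongr
  exact SchwartzMap.norm_le_seminorm ℝ f _

theorem continuous_partialFourier (f : 𝓢(EuclideanSpace ℝ (Fin (d + 1)), ℂ)) :
    Continuous fun z : ℝ × EuclideanSpace ℝ (Fin d) => partialFourier f z.1 z.2 := by
  obtain ⟨C, -, hC⟩ := exists_norm_snocPoint_le f 0
  simp only [partialFourier, Real.fourier_eq]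
  refine continuous_of_dominated (bound := fun t => C * (1 + ‖t‖) ^ (-2 : ℝ)) (fun z => ?_)
    (fun z => .of_forall fun t => ?_)
    ((integrable_one_add_norm (E := ℝ) (r := 2) (by simp)).const_mul C)
    (.of_forall fun t => ?_)
  · exact Continuous.aestronglyMeasurable (by fun_prop)
  · rw [Circle.norm_smul]
    simpa using hC z.2 t
  · fun_prop

theorem integrable_comp_snocPoint (f : 𝓢(EuclideanSpace ℝ (Fin (d + 1)), ℂ)) :
    Integrable (fun z : EuclideanSpace ℝ (Fin d) × ℝ => f (snocPoint z.1 z.2))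
      (volume.prod volume) :=
  measurePreserving_snocPoint.integrable_comp_of_integrable f.integrable

theorem fourier_snocPoint (f : 𝓢(EuclideanSpace ℝ (Fin (d + 1)), ℂ))
    (ξ : EuclideanSpace ℝ (Fin d)) (u : ℝ) :
    𝓕 (f : EuclideanSpace ℝ (Fin (d + 1)) → ℂ) (snocPoint ξ u) = 𝓕 (partialFourier f u) ξ := by
  rw [Real.fourier_eq, Real.fourier_eq, ← measurePreserving_snocPoint.map_eq,
    integral_map measurePreserving_snocPoint.aemeasurable
      (Continuous.aestronglyMeasurable (by fun_prop)), integral_prod]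
  · refine integral_congr_ae (.of_forall fun x => ?_)
    simp only [partialFourier, Real.fourier_eq]
    rw [Circle.smul_def, ← integral_smul]
    refine integral_congr_ae (.of_forall fun t => ?_)
    simp only [inner_snocPoint]
    rw [← Circle.smul_def, smul_smul, ← AddChar.map_add_eq_mul]
    congr 2
    simp
    ring
  · refine (integrable_comp_snocPoint f).mono (Continuous.aestronglyMeasurable (by fun_prop))
      (.of_forall fun z => ?_)
    rw [Circle.norm_smul]

theorem integrable_partialFourier (f : 𝓢(EuclideanSpace ℝ (Fin (d + 1)), ℂ)) (u : ℝ) :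
    Integrable (partialFourier f u) := by
  refine (integrable_comp_snocPoint f).norm.integral_prod_left.mono
    (((continuous_partialFourier f).comp (Continuous.prodMk_right u)).aestronglyMeasurable)
    (.of_forall fun x => ?_)
  rw [partialFourier, Real.fourier_eq]
  refine (norm_integral_le_integral_norm _).trans ?_
  simp_rw [Circle.norm_smul]
  exact le_abs_self _

/-- Each slice of the partial Fourier transform of a Schwartz function is a Schwartz function. -/
theorem exists_schwartzMap_eq_partialFourier (f : 𝓢(EuclideanSpace ℝ (Fin (d + 1)), ℂ)) (u : ℝ) :
    ∃ F : 𝓢(EuclideanSpace ℝ (Fin d), ℂ), ∀ x, F x = partialFourier f u x := by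
  have hfun : (fun ξ : EuclideanSpace ℝ (Fin d) => snocPoint ξ u) =
      fun ξ => (snocZero d).toContinuousLinearMap ξ + snocPoint 0 u :=
    funext fun ξ => snocPoint_eq_snocZero_add ξ u
  have hg : Function.HasTemperateGrowth fun ξ : EuclideanSpace ℝ (Fin d) => snocPoint ξ u := by
    rw [hfun]
    exact (ContinuousLinearMap.hasTemperateGrowth _).add (.const _)
  have hanti : AntilipschitzWith 1 fun ξ : EuclideanSpace ℝ (Fin d) => snocPoint ξ u := by
    rw [hfun]
    refine Isometry.antilipschitz (Isometry.of_dist_eq fun x y => ?_)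
    rw [dist_add_right]
    exact (snocZero d).dist_map x y
  -- The Schwartz property is read off on the Fourier side: the full transform of `f` restricted to
  -- the hyperplane at height `u` is Schwartz and equals the transform of the slice, so Fourier
  -- inversion recovers the slice.
  let G : 𝓢(EuclideanSpace ℝ (Fin d), ℂ) := SchwartzMap.compCLMOfAntilipschitz ℝ hg hanti (𝓕 f)
  have hG : ⇑G = 𝓕 (partialFourier f u) := by
    funext ξ
    rw [← fourier_snocPoint]
    simp [G, SchwartzMap.fourier_coe]
  refine ⟨𝓕⁻ G, fun x => ?_⟩
  have hc : Continuous (partialFourier f u) :=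
    (continuous_partialFourier f).comp (Continuous.prodMk_right u)
  rw [SchwartzMap.fourierInv_coe, hG,
    hc.fourierInv_fourier_eq (integrable_partialFourier f u) (hG ▸ G.integrable)]

end Slices

/-! ### Restriction bounds and their invariance under isometries and dilations. -/

section RestrictionBound

/-- A restriction estimate with finite exponents, in terms of integrals of powers. -/
def RestrictionBound {N : ℕ} (σ : Measure (EuclideanSpace ℝ (Fin N))) (p q : ℝ) : Prop :=
  ∃ C : ℝ≥0, ∀ f : 𝓢(EuclideanSpace ℝ (Fin N), ℂ),
    ∫⁻ ξ, ‖𝓕 (f : EuclideanSpace ℝ (Fin N) → ℂ) ξ‖ₑ ^ q ∂σ ≤ C * (∫⁻ x, ‖f x‖ₑ ^ p) ^ (q / p)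

variable {N : ℕ} {σ τ : Measure (EuclideanSpace ℝ (Fin N))}

theorem restrictionEstimate_iff_restrictionBound {p q : ℝ≥0∞} (hp0 : p ≠ 0) (hpt : p ≠ ∞)
    (hq0 : q ≠ 0) (hqt : q ≠ ∞) :
    RestrictionEstimate σ p q ↔ RestrictionBound σ p.toReal q.toReal := by
  have hp : 0 < p.toReal := ENNReal.toReal_pos hp0 hpt
  have hq : 0 < q.toReal := ENNReal.toReal_pos hq0 hqt
  unfold RestrictionEstimate RestrictionBound
  simp only [eLpNorm_eq_lintegral_rpow_enorm_toReal hp0 hpt,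
    eLpNorm_eq_lintegral_rpow_enorm_toReal hq0 hqt]
  constructor
  · rintro ⟨C, hC⟩
    refine ⟨C ^ q.toReal, fun f => ?_⟩
    have h := ENNReal.rpow_le_rpow (hC f) hq.le
    rw [← ENNReal.rpow_mul, one_div, inv_mul_cancel₀ hq.ne', ENNReal.rpow_one,
      ENNReal.mul_rpow_of_nonneg _ _ hq.le, ← ENNReal.rpow_mul, one_div_mul_eq_div] at h
    rwa [ENNReal.coe_rpow_of_nonneg _ hq.le]
  · rintro ⟨C, hC⟩
    refine ⟨C ^ (1 / q.toReal), fun f => ?_⟩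
    have h := ENNReal.rpow_le_rpow (hC f) (z := 1 / q.toReal) (by positivity)
    rw [ENNReal.mul_rpow_of_nonneg _ _ (by positivity), ← ENNReal.rpow_mul] at h
    rw [ENNReal.coe_rpow_of_nonneg _ (by positivity)]
    convert h using 3
    field_simp

theorem SchwartzMap.continuous_fourier (f : 𝓢(EuclideanSpace ℝ (Fin N), ℂ)) :
    Continuous (𝓕 (f : EuclideanSpace ℝ (Fin N) → ℂ)) := by
  rw [← SchwartzMap.fourier_coe]
  exact (𝓕 f).continuous

theorem RestrictionBound.mono {p q : ℝ} (h : RestrictionBound τ p q) (hle : σ ≤ τ) :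
    RestrictionBound σ p q :=
  h.imp fun _ hC f => (lintegral_mono' hle le_rfl).trans (hC f)

theorem RestrictionBound.add {p q : ℝ} (hσ : RestrictionBound σ p q)
    (hτ : RestrictionBound τ p q) : RestrictionBound (σ + τ) p q := by
  obtain ⟨C, hC⟩ := hσ
  obtain ⟨D, hD⟩ := hτ
  refine ⟨C + D, fun f => ?_⟩
  rw [lintegral_add_measure, ENNReal.coe_add, add_mul]
  exact add_le_add (hC f) (hD f)

/-- Composition with a linear isometry commutes with the Fourier transform and preserves `L^p`
norms. -/
theorem RestrictionBound.map {p q : ℝ} (hσ : RestrictionBound σ p q)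
    (A : EuclideanSpace ℝ (Fin N) ≃ₗᵢ[ℝ] EuclideanSpace ℝ (Fin N)) :
    RestrictionBound (σ.map A) p q := by
  obtain ⟨C, hC⟩ := hσ
  refine ⟨C, fun f => ?_⟩
  have hfm := f.continuous_fourier.measurable
  have h := hC (SchwartzMap.compCLMOfContinuousLinearEquiv ℝ A.toContinuousLinearEquiv f)
  have hcoe : ⇑(SchwartzMap.compCLMOfContinuousLinearEquiv ℝ A.toContinuousLinearEquiv f) =
      f ∘ A := by ext; simp
  rw [hcoe] at h
  simp only [Real.fourier_comp_linearIsometry] at h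
  rw [lintegral_map (by fun_prop) A.continuous.measurable]
  refine h.trans (le_of_eq ?_)
  congr 2
  exact A.measurePreserving.lintegral_comp (f := fun x => ‖f x‖ₑ ^ p)
    (by have := f.continuous.measurable; fun_prop)

theorem lintegral_comp_smul_euclidean {F : EuclideanSpace ℝ (Fin N) → ℝ≥0∞} (hF : Measurable F)
    {c : ℝ} (hc : 0 < c) :
    ∫⁻ x, F (c • x) = ENNReal.ofReal ((c ^ N)⁻¹) * ∫⁻ x, F x := by
  rw [← lintegral_map hF (by fun_prop), Measure.map_addHaar_smul _ hc.ne', lintegral_smul_measure,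
    finrank_euclideanSpace_fin, abs_of_pos (by positivity), smul_eq_mul]

/-- The function is `u^{-N} F(x/u)`; its normalization makes the transform exactly `F̂(uη)`. -/
theorem exists_schwartzMap_dilation (F : 𝓢(EuclideanSpace ℝ (Fin N), ℂ)) {u p : ℝ} (hu : 0 < u)
    (hp : 0 < p) :
    ∃ H : 𝓢(EuclideanSpace ℝ (Fin N), ℂ),
      (∀ η, 𝓕 (H : EuclideanSpace ℝ (Fin N) → ℂ) η =
        𝓕 (F : EuclideanSpace ℝ (Fin N) → ℂ) (u • η)) ∧
      ∫⁻ x, ‖H x‖ₑ ^ p = ENNReal.ofReal (u ^ (N * (1 - p))) * ∫⁻ x, ‖F x‖ₑ ^ p := by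
  let A : EuclideanSpace ℝ (Fin N) ≃L[ℝ] EuclideanSpace ℝ (Fin N) :=
    ContinuousLinearEquiv.smulLeft (Units.mk0 u⁻¹ (inv_ne_zero hu.ne'))
  have hA : ∀ x, A x = u⁻¹ • x := fun x => rfl
  let H : 𝓢(EuclideanSpace ℝ (Fin N), ℂ) :=
    ((u ^ N)⁻¹ : ℝ) • SchwartzMap.compCLMOfContinuousLinearEquiv ℝ A F
  have hH : ∀ x, H x = ((u ^ N)⁻¹ : ℝ) • F (u⁻¹ • x) := fun x => by simp [H, hA]
  refine ⟨H, fun η => ?_, ?_⟩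
  · rw [Real.fourier_eq, Real.fourier_eq]
    have := Measure.integral_comp_inv_smul_of_nonneg volume
      (fun y : EuclideanSpace ℝ (Fin N) => Real.fourierChar (-inner ℝ y (u • η)) • F y) hu.le
    rw [finrank_euclideanSpace_fin, eq_comm, ← eq_inv_smul_iff₀ (by positivity)] at this
    rw [this, ← integral_smul]
    refine integral_congr_ae (.of_forall fun x => ?_)
    simp only [hH, inner_smul_left, inner_smul_right]
    rw [smul_comm]
    congr 4
    simp [hu.ne']
  · have hm : Measurable fun x => ‖F x‖ₑ ^ p := by
      have := F.continuous.measurable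
      fun_prop
    have e : ∀ x, ‖H x‖ₑ ^ p = ENNReal.ofReal (((u ^ N)⁻¹) ^ p) * ‖F (u⁻¹ • x)‖ₑ ^ p := fun x => by
      rw [hH, enorm_smul, ENNReal.mul_rpow_of_nonneg _ _ hp.le, Real.enorm_of_nonneg (by positivity),
        ENNReal.ofReal_rpow_of_nonneg (by positivity) hp.le]
    simp_rw [e]
    rw [lintegral_const_mul' _ _ ENNReal.ofReal_ne_top,
      lintegral_comp_smul_euclidean hm (inv_pos.2 hu), ← mul_assoc,
      ← ENNReal.ofReal_mul (by positivity)]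
    congr 2
    rw [← Real.rpow_natCast, ← Real.rpow_natCast, ← Real.rpow_neg hu.le, ← Real.rpow_mul hu.le,
      Real.inv_rpow hu.le, inv_inv, ← Real.rpow_add hu]
    congr 1
    ring

end RestrictionBound

/-! ### From a surface to the cone over it. -/

section Cone

variable {d : ℕ}

/-- The `p`-th power of the `L^p` norm of the slices of the partial Fourier transform. -/
noncomputable def sliceIntegral (f : EuclideanSpace ℝ (Fin (d + 1)) → ℂ) (p u : ℝ) : ℝ≥0∞ :=
  ∫⁻ x, ‖partialFourier f u x‖ₑ ^ p

theorem measurable_enorm_partialFourier_rpow (f : 𝓢(EuclideanSpace ℝ (Fin (d + 1)), ℂ)) (p : ℝ) :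
    Measurable fun z : ℝ × EuclideanSpace ℝ (Fin d) => ‖partialFourier f z.1 z.2‖ₑ ^ p := by
  have := (continuous_partialFourier f).measurable
  fun_prop

@[fun_prop]
theorem measurable_sliceIntegral (f : 𝓢(EuclideanSpace ℝ (Fin (d + 1)), ℂ)) (p : ℝ) :
    Measurable (sliceIntegral f p) :=
  (measurable_enorm_partialFourier_rpow f p).lintegral_prod_right'

/-- The slice at height `u` is the surface dilated by `u`, so the hypothesis is applied to the
dilate of the slice `f_u`. The constant does not depend on `u`; all dependence is in the explicit
power. -/
theorem RestrictionBound.exists_slice_le {σ : Measure (EuclideanSpace ℝ (Fin d))} {p q : ℝ}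
    (hp : 0 < p) (hq : 0 < q) (hσ : RestrictionBound σ p q) :
    ∃ C : ℝ≥0, ∀ f : 𝓢(EuclideanSpace ℝ (Fin (d + 1)), ℂ), ∀ u : ℝ, 0 < u →
      ∫⁻ η, ‖𝓕 (f : EuclideanSpace ℝ (Fin (d + 1)) → ℂ) (snocPoint (u • η) u)‖ₑ ^ q ∂σ ≤
        C * (ENNReal.ofReal (u ^ (d * (1 - p) * (q / p))) * sliceIntegral f p u ^ (q / p)) := by
  obtain ⟨C, hC⟩ := hσ
  refine ⟨C, fun f u hu => ?_⟩
  obtain ⟨F, hF⟩ := exists_schwartzMap_eq_partialFourier f u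
  obtain ⟨H, hH1, hH2⟩ := exists_schwartzMap_dilation F hu hp
  have hF' : ⇑F = partialFourier f u := funext hF
  have h := hC H
  rw [hH2] at h
  simp only [hH1, hF', ← fourier_snocPoint] at h
  refine h.trans (le_of_eq ?_)
  rw [ENNReal.mul_rpow_of_nonneg _ _ (by positivity), ENNReal.ofReal_rpow_of_nonneg (by positivity)
    (by positivity), ← Real.rpow_mul hu.le]
  rfl

/-- Paley's inequality on each line with `x` fixed, followed by Tonelli; the exponent is `p` on both
sides, so Minkowski is not needed. -/
theorem exists_lintegral_sliceIntegral_mul_le {p : ℝ} (hp1 : 1 < p) (hp2 : p < 2) :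
    ∃ C : ℝ≥0, ∀ f : 𝓢(EuclideanSpace ℝ (Fin (d + 1)), ℂ),
      ∫⁻ u in Set.Ioi (0 : ℝ), sliceIntegral f p u * ENNReal.ofReal (u ^ (p - 2)) ≤
        C * ∫⁻ x, ‖f x‖ₑ ^ p := by
  obtain ⟨C, hC⟩ := exists_lintegral_fourier_rpow_mul_le hp1 hp2
  refine ⟨C, fun f => ?_⟩
  have hfm := f.continuous.measurable
  have hm := measurable_enorm_partialFourier_rpow f p
  calc ∫⁻ u in Set.Ioi (0 : ℝ), sliceIntegral f p u * ENNReal.ofReal (u ^ (p - 2))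
      = ∫⁻ u in Set.Ioi (0 : ℝ), ∫⁻ x, ‖partialFourier f u x‖ₑ ^ p *
          ENNReal.ofReal (u ^ (p - 2)) := by
        refine lintegral_congr fun u => ?_
        rw [sliceIntegral, lintegral_mul_const' _ _ ENNReal.ofReal_ne_top]
    _ = ∫⁻ x, ∫⁻ u in Set.Ioi (0 : ℝ), ‖partialFourier f u x‖ₑ ^ p *
          ENNReal.ofReal (u ^ (p - 2)) :=
        lintegral_lintegral_swap (Measurable.aemeasurable (hm.mul (by fun_prop)))
    _ ≤ ∫⁻ x, C * ∫⁻ t, ‖f (snocPoint x t)‖ₑ ^ p := by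
        refine lintegral_mono fun x => ?_
        exact hC (fun t => f (snocPoint x t)) (by fun_prop) (integrable_snocPoint_section f x)
          (memLp_two_snocPoint_section f x)
    _ = C * ∫⁻ x, ‖f x‖ₑ ^ p := by
        rw [lintegral_const_mul' _ _ ENNReal.coe_ne_top, ← lintegral_snocPoint (F := fun w => ‖f w‖ₑ ^ p) (by fun_prop)]

theorem lintegral_sliceIntegral_rpow_le (f : 𝓢(EuclideanSpace ℝ (Fin (d + 1)), ℂ)) {p s : ℝ}
    (hs : 1 ≤ s) :
    (∫⁻ u, sliceIntegral f p u ^ s) ^ (1 / s) ≤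
      ∫⁻ x, (∫⁻ u, ‖partialFourier f u x‖ₑ ^ (p * s)) ^ (1 / s) := by
  have hm : Measurable (Function.uncurry
      fun (x : EuclideanSpace ℝ (Fin d)) (u : ℝ) => ‖partialFourier f u x‖ₑ ^ p) := by
    have h := (measurable_enorm_partialFourier_rpow f p).comp (measurable_snd.prodMk measurable_fst :
      Measurable fun z : EuclideanSpace ℝ (Fin d) × ℝ => (z.2, z.1))
    simpa only [Function.comp_def, Function.uncurry_def] using h
  have h := lintegral_lintegral_rpow_le (μ := volume) (ν := volume) hm hs
  simp only [← ENNReal.rpow_mul] at h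
  exact h

/-- Hausdorff–Young holds on lines with `x` fixed, whereas the `x` integral here is innermost.
Minkowski with exponent `r/p ≥ 1` exchanges the two norms. -/
theorem exists_lintegral_sliceIntegral_rpow_le {p r : ℝ} (hpr : p.HolderConjugate r)
    (hp2 : p < 2) :
    ∃ C : ℝ≥0, ∀ f : 𝓢(EuclideanSpace ℝ (Fin (d + 1)), ℂ),
      ∫⁻ u, sliceIntegral f p u ^ (r / p) ≤ C * (∫⁻ x, ‖f x‖ₑ ^ p) ^ (r / p) := by
  obtain ⟨C, hC⟩ := exists_lintegral_fourier_rpow_conj_le hpr hp2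
  have hp0 : 0 < p := hpr.pos
  have hr0 : 0 < r := hpr.symm.pos
  set s := r / p with hs
  have hs0 : 0 < s := by positivity
  have hs1 : 1 ≤ s := by
    rw [hs, one_le_div hp0]
    have := hpr.mul_eq_add
    nlinarith
  have hps : p * s = r := by rw [hs]; field_simp
  refine ⟨C, fun f => ?_⟩
  have hfm := f.continuous.measurable
  have hbound : ∫⁻ x : EuclideanSpace ℝ (Fin d),
      (∫⁻ u : ℝ, ‖partialFourier f u x‖ₑ ^ r) ^ (1 / s) ≤
      C ^ (1 / s) * ∫⁻ x, ‖f x‖ₑ ^ p := by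
    rw [lintegral_snocPoint (F := fun w => ‖f w‖ₑ ^ p) (by fun_prop),
      ← lintegral_const_mul' _ _ (ENNReal.rpow_ne_top_of_nonneg (by positivity) ENNReal.coe_ne_top)]
    refine lintegral_mono fun x => ?_
    have h := hC (fun t => f (snocPoint x t)) (by fun_prop) (integrable_snocPoint_section f x)
      (memLp_two_snocPoint_section f x)
    have h' := ENNReal.rpow_le_rpow h (z := 1 / s) (by positivity)
    rwa [ENNReal.mul_rpow_of_nonneg _ _ (by positivity), ← ENNReal.rpow_mul,
      mul_one_div_cancel hs0.ne', ENNReal.rpow_one] at h'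
  have hmink := lintegral_sliceIntegral_rpow_le f (p := p) hs1
  rw [hps] at hmink
  have h := ENNReal.rpow_le_rpow (hmink.trans hbound) hs0.le
  rwa [← ENNReal.rpow_mul, one_div_mul_cancel hs0.ne', ENNReal.rpow_one,
    ENNReal.mul_rpow_of_nonneg _ _ hs0.le, ← ENNReal.rpow_mul, one_div_mul_cancel hs0.ne',
    ENNReal.rpow_one] at h

/-- The measure on the cone over `σ` which has density `u^{d-1} du` in the axial variable
`u ∈ I`. -/
noncomputable def conicalMeasure (σ : Measure (EuclideanSpace ℝ (Fin (d + 1)))) (I : Set ℝ) :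
    Measure (EuclideanSpace ℝ (Fin (d + 1 + 1))) :=
  (σ.prod ((volume.restrict I).withDensity fun u => ENNReal.ofReal (u ^ ((d : ℝ) - 1)))).map
    fun z => snocPoint (z.2 • z.1) z.2

theorem lintegral_conicalMeasure (σ : Measure (EuclideanSpace ℝ (Fin (d + 1)))) [SFinite σ]
    (I : Set ℝ) {F : EuclideanSpace ℝ (Fin (d + 1 + 1)) → ℝ≥0∞} (hF : Measurable F) :
    ∫⁻ w, F w ∂(conicalMeasure σ I) =
      ∫⁻ u in I, ENNReal.ofReal (u ^ ((d : ℝ) - 1)) * ∫⁻ η, F (snocPoint (u • η) u) ∂σ := by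
  rw [conicalMeasure, lintegral_map hF (by fun_prop), lintegral_prod_symm _ (by fun_prop),
    lintegral_withDensity_eq_lintegral_mul _ (by fun_prop)]
  · rfl
  · exact Measurable.lintegral_prod_left' (f := fun z : _ × ℝ => F (snocPoint (z.2 • z.1) z.2))
      (by fun_prop)

/-- The exponent of `u` adds the density `d - 1` of the conical measure to the scaling exponent `(d
+ 1)(1 - p)(q/p)` of a slice. -/
theorem RestrictionBound.exists_lintegral_conicalMeasure_le
    {σ : Measure (EuclideanSpace ℝ (Fin (d + 1)))} [SFinite σ] {p q : ℝ} (hp : 0 < p) (hq : 0 < q)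
    (hσ : RestrictionBound σ p q) :
    ∃ C : ℝ≥0, ∀ f : 𝓢(EuclideanSpace ℝ (Fin (d + 1 + 1)), ℂ), ∀ I ⊆ Set.Ioi (0 : ℝ),
      MeasurableSet I → ∫⁻ w, ‖𝓕 (f : EuclideanSpace ℝ (Fin (d + 1 + 1)) → ℂ) w‖ₑ ^ q
        ∂(conicalMeasure σ I) ≤
      C * ∫⁻ u in I, ENNReal.ofReal (u ^ ((d : ℝ) - 1 + (d + 1) * (1 - p) * (q / p))) *
        sliceIntegral f p u ^ (q / p) := by
  obtain ⟨C, hC⟩ := hσ.exists_slice_le hp hq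
  refine ⟨C, fun f I hI hIm => ?_⟩
  have hfm := f.continuous_fourier.measurable
  rw [lintegral_conicalMeasure _ _ (by fun_prop), ← lintegral_const_mul' _ _ ENNReal.coe_ne_top]
  refine setLIntegral_mono' hIm fun u hu => ?_
  have hu0 : 0 < u := hI hu
  refine (mul_le_mul_right (hC f u hu0) _).trans (le_of_eq ?_)
  rw [Real.rpow_add hu0, ENNReal.ofReal_mul (by positivity)]
  push_cast
  ring

/-- In the scale invariant case, a restriction bound passes to the cone. -/
theorem RestrictionBound.conicalMeasure_Ioi {σ : Measure (EuclideanSpace ℝ (Fin (d + 1)))}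
    [SFinite σ] {p q r : ℝ} (hpr : p.HolderConjugate r) (hp2 : p < 2)
    (hqr : q * (d + 2) = r * d) (hpq : p ≤ q) (hσ : RestrictionBound σ p q) :
    RestrictionBound (conicalMeasure σ (Set.Ioi 0)) p q := by
  have hp0 : 0 < p := hpr.pos
  have hp1 : 1 < p := hpr.lt
  have hr0 : 0 < r := hpr.symm.pos
  have hq0 : 0 < q := by linarith
  have hmul := hpr.mul_eq_add
  have hd2 : (0 : ℝ) < d + 2 := by positivity
  obtain ⟨C, hC⟩ := hσ.exists_lintegral_conicalMeasure_le hp0 hq0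
  obtain ⟨D, hD⟩ := exists_lintegral_sliceIntegral_mul_le (d := d + 1) hp1 hp2
  obtain ⟨D', hD'⟩ := exists_lintegral_sliceIntegral_rpow_le (d := d + 1) hpr hp2
  -- The value is forced by the weight: the total power of `u` is `-2/(d+2)` in the scale invariant
  -- case, and it must equal `θ(p - 2)`. The exponent identity `θp + (1-θ)r = q` below then holds
  -- automatically.
  set θ : ℝ := 2 / ((d + 2) * (2 - p)) with hθ
  have hp2' : 0 < 2 - p := by linarith
  have hθ0 : 0 ≤ θ := by positivity
  have hrr : r = p / (p - 1) := by
    have : p - 1 ≠ 0 := by linarith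
    field_simp
    linarith
  have hp1' : 0 < p - 1 := by linarith
  have hθq : θ * p + (1 - θ) * r = q := by
    have hq' : q = r * d / (d + 2) := by field_simp; linarith
    rw [hq', hθ, hrr]
    field_simp
    ring
  -- Since `q = p + (1-θ)(r-p)` and `p < r`, the hypothesis `p ≤ q` is what gives `θ ≤ 1`.
  have hθ1 : 0 ≤ 1 - θ := by
    have : 0 < r := hr0
    by_contra hneg
    push Not at hneg
    have hrp : p < r := by
      rw [hrr, lt_div_iff₀ hp1']
      nlinarith
    nlinarith
  refine ⟨C * (D ^ θ * D' ^ (1 - θ)), fun f => (hC f _ subset_rfl measurableSet_Ioi).trans ?_⟩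
  rw [ENNReal.coe_mul, mul_assoc (C : ℝ≥0∞)]
  gcongr
  set X := ∫⁻ x, ‖f x‖ₑ ^ p with hX
  calc ∫⁻ u in Set.Ioi (0 : ℝ), ENNReal.ofReal (u ^ ((d : ℝ) - 1 + (d + 1) * (1 - p) * (q / p))) *
        sliceIntegral f p u ^ (q / p)
      = ∫⁻ u in Set.Ioi (0 : ℝ), (sliceIntegral f p u * ENNReal.ofReal (u ^ (p - 2))) ^ θ *
          (sliceIntegral f p u ^ (r / p)) ^ (1 - θ) := by
        refine setLIntegral_congr_fun measurableSet_Ioi fun u hu => ?_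
        have hu : 0 < u := hu
        rw [ENNReal.mul_rpow_of_nonneg _ _ hθ0, ← ENNReal.rpow_mul,
          ENNReal.ofReal_rpow_of_nonneg (by positivity) hθ0, ← Real.rpow_mul hu.le,
          mul_right_comm (sliceIntegral f p u ^ θ), ← ENNReal.rpow_add_of_nonneg _ _ hθ0 (by positivity), mul_comm]
        congr 3
        · rw [← hθq]
          field_simp
        · have e : (1 - p) * (q / p) = -(d / (d + 2)) := by
            have hq' : q = r * d / (d + 2) := by field_simp; linarith
            rw [hq', hrr]
            field_simp
            ring
          rw [mul_assoc, e, hθ]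
          field_simp
          ring
    _ ≤ (∫⁻ u in Set.Ioi (0 : ℝ), sliceIntegral f p u * ENNReal.ofReal (u ^ (p - 2))) ^ θ *
          (∫⁻ u in Set.Ioi (0 : ℝ), sliceIntegral f p u ^ (r / p)) ^ (1 - θ) :=
        ENNReal.lintegral_mul_norm_pow_le (by fun_prop) (by fun_prop) hθ0 hθ1 (by ring)
    _ ≤ (D * X) ^ θ * (D' * X ^ (r / p)) ^ (1 - θ) := by
        gcongr
        · exact hD f
        · exact (setLIntegral_le_lintegral _ _).trans (hD' f)
    _ = _ := by
        rw [ENNReal.mul_rpow_of_nonneg _ _ hθ0, ENNReal.mul_rpow_of_nonneg _ _ hθ1,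
          ← ENNReal.rpow_mul, ENNReal.coe_mul, ENNReal.coe_rpow_of_nonneg _ hθ0,
          ENNReal.coe_rpow_of_nonneg _ hθ1]
        have : q / p = θ + r / p * (1 - θ) := by
          rw [← hθq]
          field_simp
        rw [this, ENNReal.rpow_add_of_nonneg _ _ hθ0 (by positivity)]
        ring

/-- A restriction bound passes to the compact pieces of the cone. -/
theorem RestrictionBound.conicalMeasure_Icc {σ : Measure (EuclideanSpace ℝ (Fin (d + 1)))}
    [SFinite σ] {p q r : ℝ} (hpr : p.HolderConjugate r) (hp2 : p < 2) (hq0 : 0 < q) (hqr : q ≤ r)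
    (hσ : RestrictionBound σ p q) {a : ℝ} (ha : 0 < a) (b : ℝ) :
    RestrictionBound (conicalMeasure σ (Set.Icc a b)) p q := by
  have hp0 : 0 < p := hpr.pos
  have hr0 : 0 < r := hpr.symm.pos
  obtain ⟨C, hC⟩ := hσ.exists_lintegral_conicalMeasure_le hp0 hq0
  obtain ⟨D, hD⟩ := exists_lintegral_sliceIntegral_rpow_le (d := d + 1) hpr hp2
  set e : ℝ := (d : ℝ) - 1 + (d + 1) * (1 - p) * (q / p) with he
  obtain ⟨M, hM⟩ := isCompact_Icc.exists_bound_of_continuousOn (s := Set.Icc a b)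
    (f := fun u : ℝ => u ^ e)
    (continuousOn_id.rpow_const fun u hu => Or.inl (ha.trans_le hu.1).ne')
  have hsub : Set.Icc a b ⊆ Set.Ioi 0 := fun u hu => ha.trans_le hu.1
  -- Hölder against the constant `1` on an interval of length `b - a` lowers the exponent from `r`
  -- to `q`.
  have h1 : 0 ≤ 1 - q / r := by rw [sub_nonneg, div_le_one hr0]; exact hqr
  refine ⟨C * (M.toNNReal * (D ^ (q / r) * (b - a).toNNReal ^ (1 - q / r))),
    fun f => (hC f _ hsub measurableSet_Icc).trans ?_⟩
  rw [ENNReal.coe_mul, mul_assoc (C : ℝ≥0∞)]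
  gcongr
  set X := ∫⁻ x, ‖f x‖ₑ ^ p with hX
  calc ∫⁻ u in Set.Icc a b, ENNReal.ofReal (u ^ e) * sliceIntegral f p u ^ (q / p)
      ≤ ∫⁻ u in Set.Icc a b, ENNReal.ofReal M * sliceIntegral f p u ^ (q / p) := by
        refine setLIntegral_mono' measurableSet_Icc fun u hu => ?_
        gcongr
        exact (le_abs_self _).trans (hM u hu)
    _ = ENNReal.ofReal M * ∫⁻ u in Set.Icc a b,
          (sliceIntegral f p u ^ (r / p)) ^ (q / r) * 1 ^ (1 - q / r) := by
        rw [lintegral_const_mul' _ _ ENNReal.ofReal_ne_top]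
        congr 1
        refine lintegral_congr fun u => ?_
        rw [ENNReal.one_rpow, mul_one, ← ENNReal.rpow_mul]
        congr 1
        field_simp
    _ ≤ ENNReal.ofReal M * ((∫⁻ u in Set.Icc a b, sliceIntegral f p u ^ (r / p)) ^ (q / r) *
          (∫⁻ u in Set.Icc a b, 1) ^ (1 - q / r)) := by
        gcongr
        exact ENNReal.lintegral_mul_norm_pow_le (f := fun u => sliceIntegral f p u ^ (r / p))
          (g := fun _ => 1) (by fun_prop) (by fun_prop) (by positivity) h1 (by ring)
    _ ≤ ENNReal.ofReal M * ((D * X ^ (r / p)) ^ (q / r) *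
          ENNReal.ofReal (b - a) ^ (1 - q / r)) := by
        gcongr
        · exact (setLIntegral_le_lintegral _ _).trans (hD f)
        · simp
    _ = _ := by
        have hqr0 : 0 ≤ q / r := by positivity
        rw [ENNReal.mul_rpow_of_nonneg _ _ hqr0, ← ENNReal.rpow_mul, ENNReal.coe_mul,
          ENNReal.coe_mul, ENNReal.coe_rpow_of_nonneg _ hqr0, ENNReal.coe_rpow_of_nonneg _ h1]
        have : r / p * (q / r) = q / p := by field_simp
        rw [this]
        change ENNReal.ofReal M * (_ * ENNReal.ofReal (b - a) ^ _) = ENNReal.ofReal M *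
          (_ * ENNReal.ofReal (b - a) ^ _) * _
        ring

end Cone

/-! ### Slicing the light cone by spheres, hyperboloids and paraboloids. -/

section ConeGeometry

variable {d : ℕ}

instance (N : ℕ) : SFinite (sphereMeasure N) := by unfold sphereMeasure; infer_instance

instance (N : ℕ) : SFinite (paraboloidMeasure N) := by unfold paraboloidMeasure; infer_instance

instance (N : ℕ) : SFinite (hyperboloidMeasure N) := by unfold hyperboloidMeasure; infer_instance

theorem lintegral_lightConeMeasure {n : ℕ} {F : EuclideanSpace ℝ (Fin (n + 1)) → ℝ≥0∞}
    (hF : Measurable F) :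
    ∫⁻ w, F w ∂(lightConeMeasure n) =
      ∫⁻ ξ : EuclideanSpace ℝ (Fin n), ENNReal.ofReal (1 / ‖ξ‖) * F (snocPoint ξ ‖ξ‖) := by
  rw [lightConeMeasure, lintegral_map hF (by fun_prop),
    lintegral_withDensity_eq_lintegral_mul _ (by fun_prop) (by fun_prop)]
  rfl

theorem norm_snocPoint (x : EuclideanSpace ℝ (Fin d)) (s : ℝ) :
    ‖snocPoint x s‖ = √(‖x‖ ^ 2 + s ^ 2) := by
  rw [← norm_snocPoint_sq, Real.sqrt_sq (norm_nonneg _)]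

theorem lintegral_lightConeMeasure_snocPoint
    {F : EuclideanSpace ℝ (Fin (d + 1 + 1)) → ℝ≥0∞} (hF : Measurable F) :
    ∫⁻ w, F w ∂(lightConeMeasure (d + 1)) =
      ∫⁻ x : EuclideanSpace ℝ (Fin d), ∫⁻ s : ℝ, ENNReal.ofReal (1 / √(‖x‖ ^ 2 + s ^ 2)) *
        F (snocPoint (snocPoint x s) √(‖x‖ ^ 2 + s ^ 2)) := by
  rw [lintegral_lightConeMeasure hF, lintegral_snocPoint (by fun_prop)]
  simp only [norm_snocPoint]

/-- Polar coordinates on the light cone. -/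
theorem lintegral_conicalMeasure_sphereMeasure
    {F : EuclideanSpace ℝ (Fin (d + 1 + 1)) → ℝ≥0∞} (hF : Measurable F) :
    ∫⁻ w, F w ∂(conicalMeasure (sphereMeasure (d + 1)) (Set.Ioi 0)) =
      ∫⁻ w, F w ∂(lightConeMeasure (d + 1)) := by
  set E := EuclideanSpace ℝ (Fin (d + 1))
  let G : E → ℝ≥0∞ := fun ξ => ENNReal.ofReal (1 / ‖ξ‖) * F (snocPoint ξ ‖ξ‖)
  have hG : Measurable G := by fun_prop
  have hinner : ∀ u : ℝ, Measurable fun η : E => F (snocPoint (u • η) u) := fun u => by fun_prop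
  -- Lebesgue measure is `u^d du dω` in polar coordinates; the invariant factor `1/|ξ|` lowers the
  -- power to `u^{d-1}`.
  have hpres := Measure.measurePreserving_homeomorphUnitSphereProd (volume : Measure E)
  rw [finrank_euclideanSpace_fin, Nat.add_sub_cancel] at hpres
  have h1 : ∫⁻ ξ, G ξ = ∫⁻ z : Metric.sphere (0 : E) 1 × Set.Ioi (0 : ℝ), G (z.2.1 • z.1.1)
      ∂((volume : Measure E).toSphere.prod (Measure.volumeIoiPow d)) := by
    rw [← hpres.lintegral_comp (by fun_prop)]
    have : ∀ ξ : ({0}ᶜ : Set E), G ((homeomorphUnitSphereProd E ξ).2.1 •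
        (homeomorphUnitSphereProd E ξ).1.1) = G ξ := by
      intro ξ
      have hξ : ‖(ξ : E)‖ ≠ 0 := norm_ne_zero_iff.2 ξ.2
      congr 1
      simp [smul_smul, hξ]
    simp only [this]
    rw [lintegral_subtype_comap (measurableSet_singleton _).compl, restrict_compl_singleton]
  have h2 : ∀ H : Set.Ioi (0 : ℝ) → ℝ≥0∞, Measurable H →
      ∫⁻ u, H u ∂(Measure.volumeIoiPow d) =
        ∫⁻ u, ENNReal.ofReal (u.1 ^ d) * H u ∂(Measure.comap Subtype.val volume) := by
    intro H hH
    rw [Measure.volumeIoiPow, lintegral_withDensity_eq_lintegral_mul _ (by fun_prop) hH]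
    rfl
  rw [lintegral_conicalMeasure _ _ hF, lintegral_lightConeMeasure hF]
  change _ = ∫⁻ ξ, G ξ
  rw [h1, lintegral_prod_symm _ (by fun_prop), h2 _ (Measurable.lintegral_prod_left' (f := fun z :
      Metric.sphere (0 : E) 1 × Set.Ioi (0 : ℝ) => G (z.2.1 • z.1.1)) (by fun_prop)),
    ← lintegral_subtype_comap measurableSet_Ioi]
  refine lintegral_congr fun u => ?_
  have hu : 0 < u.1 := u.2
  rw [sphereMeasure, lintegral_map (hinner _) measurable_subtype_coe,
    ← lintegral_const_mul' _ _ ENNReal.ofReal_ne_top,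
    ← lintegral_const_mul' _ _ ENNReal.ofReal_ne_top]
  refine lintegral_congr fun ω => ?_
  have hω : ‖u.1 • ω.1‖ = u.1 := by
    rw [norm_smul, norm_eq_of_mem_sphere ω, mul_one, Real.norm_of_nonneg hu.le]
  simp only [G, hω, ← mul_assoc]
  rw [← ENNReal.ofReal_mul (by positivity), Real.rpow_sub hu, Real.rpow_natCast, Real.rpow_one,
    div_eq_mul_one_div]

theorem norm_initPoint_initPoint_sq (w : EuclideanSpace ℝ (Fin (d + 1 + 1))) :
    ‖w‖ ^ 2 = ‖initPoint (initPoint w)‖ ^ 2 + initPoint w (Fin.last d) ^ 2 +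
      w (Fin.last (d + 1)) ^ 2 := by
  rw [← norm_snocPoint_sq, snocPoint_initPoint, ← norm_snocPoint_sq, snocPoint_initPoint]

/-- The orthogonal map that acts on the last two coordinates by the matrix `!![a, b; c, e]`. -/
noncomputable def lastTwoIsometry (a b c e : ℝ) (h1 : a ^ 2 + c ^ 2 = 1) (h2 : b ^ 2 + e ^ 2 = 1)
    (h3 : a * b + c * e = 0) :
    EuclideanSpace ℝ (Fin (d + 1 + 1)) ≃ₗᵢ[ℝ] EuclideanSpace ℝ (Fin (d + 1 + 1)) :=
  LinearIsometry.toLinearIsometryEquiv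
    { toFun := fun w => snocPoint (snocPoint (initPoint (initPoint w))
        (a * initPoint w (Fin.last d) + b * w (Fin.last (d + 1))))
        (c * initPoint w (Fin.last d) + e * w (Fin.last (d + 1)))
      map_add' := fun v w => by
        rw [← snocPoint_add, ← snocPoint_add]
        congr 1
        · congr 1
          simp only [initPoint_apply, PiLp.add_apply]
          ring
        · simp only [initPoint_apply, PiLp.add_apply]
          ring
      map_smul' := fun r w => by
        rw [RingHom.id_apply, ← snocPoint_smul, ← snocPoint_smul]
        congr 1
        · congr 1
          simp only [initPoint_apply, PiLp.smul_apply, smul_eq_mul]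
          ring
        · simp only [initPoint_apply, PiLp.smul_apply, smul_eq_mul]
          ring
      norm_map' := fun w => by
        rw [← sq_eq_sq₀ (norm_nonneg _) (norm_nonneg _), norm_initPoint_initPoint_sq w]
        change ‖snocPoint _ _‖ ^ 2 = _
        rw [norm_snocPoint_sq, norm_snocPoint_sq]
        linear_combination (initPoint w (Fin.last d)) ^ 2 * h1 + (w (Fin.last (d + 1))) ^ 2 * h2 +
          2 * initPoint w (Fin.last d) * w (Fin.last (d + 1)) * h3 } rfl

theorem lastTwoIsometry_snocPoint {a b c e : ℝ} (h1 : a ^ 2 + c ^ 2 = 1) (h2 : b ^ 2 + e ^ 2 = 1)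
    (h3 : a * b + c * e = 0) (x : EuclideanSpace ℝ (Fin d)) (v u : ℝ) :
    lastTwoIsometry a b c e h1 h2 h3 (snocPoint (snocPoint x v) u) =
      snocPoint (snocPoint x (a * v + b * u)) (c * v + e * u) := by
  change snocPoint (snocPoint (initPoint (initPoint _)) (a * initPoint _ _ + b * snocPoint _ _ _))
    (c * initPoint _ _ + e * snocPoint _ _ _) = _
  rw [initPoint_snocPoint, initPoint_snocPoint, snocPoint_last, snocPoint_last]

/-- The isometry that exchanges the last two coordinates. -/
noncomputable def swapLastTwo (d : ℕ) :
    EuclideanSpace ℝ (Fin (d + 1 + 1)) ≃ₗᵢ[ℝ] EuclideanSpace ℝ (Fin (d + 1 + 1)) :=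
  lastTwoIsometry 0 1 1 0 (by norm_num) (by norm_num) (by norm_num)

theorem swapLastTwo_snocPoint (x : EuclideanSpace ℝ (Fin d)) (v u : ℝ) :
    swapLastTwo d (snocPoint (snocPoint x v) u) = snocPoint (snocPoint x u) v := by
  rw [swapLastTwo, lastTwoIsometry_snocPoint]
  simp

/-- The isometry to the null coordinates `(τ - s) / √2`, `(τ + s) / √2`. -/
noncomputable def nullIsometry (d : ℕ) :
    EuclideanSpace ℝ (Fin (d + 1 + 1)) ≃ₗᵢ[ℝ] EuclideanSpace ℝ (Fin (d + 1 + 1)) :=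
  lastTwoIsometry (-(√2)⁻¹) (√2)⁻¹ (√2)⁻¹ (√2)⁻¹
    (by rw [neg_sq, inv_pow, Real.sq_sqrt (by norm_num)]; norm_num)
    (by rw [inv_pow, Real.sq_sqrt (by norm_num)]; norm_num) (by ring)

theorem nullIsometry_snocPoint (x : EuclideanSpace ℝ (Fin d)) (v u : ℝ) :
    nullIsometry d (snocPoint (snocPoint x v) u) =
      snocPoint (snocPoint x ((u - v) / √2)) ((u + v) / √2) := by
  rw [nullIsometry, lastTwoIsometry_snocPoint]
  congr 2 <;> ring

theorem lintegral_euclidean_eq_smul {N : ℕ} {F : EuclideanSpace ℝ (Fin N) → ℝ≥0∞}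
    (hF : Measurable F) {c : ℝ} (hc : 0 < c) :
    ∫⁻ x, F x = ENNReal.ofReal (c ^ N) * ∫⁻ x, F (c • x) := by
  rw [lintegral_comp_smul_euclidean hF hc, ← mul_assoc, ← ENNReal.ofReal_mul (by positivity),
    mul_inv_cancel₀ (by positivity), ENNReal.ofReal_one, one_mul]

/-- The half `s > 0` of the light cone, sliced by hyperboloids. -/
theorem lintegral_conicalMeasure_hyperboloidMeasure
    {F : EuclideanSpace ℝ (Fin (d + 1 + 1)) → ℝ≥0∞} (hF : Measurable F) :
    ∫⁻ w, F (swapLastTwo d w) ∂(conicalMeasure (hyperboloidMeasure d) (Set.Ioi 0)) =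
      ∫⁻ w, {w : EuclideanSpace ℝ (Fin (d + 1 + 1)) |
        0 < initPoint w (Fin.last d)}.indicator F w ∂(lightConeMeasure (d + 1)) := by
  have hR : Measurable (swapLastTwo d) := (swapLastTwo d).continuous.measurable
  have hP : MeasurableSet {w : EuclideanSpace ℝ (Fin (d + 1 + 1)) |
      0 < initPoint w (Fin.last d)} := by
    simp only [initPoint_apply]
    exact measurableSet_lt measurable_const (by fun_prop)
  rw [lintegral_conicalMeasure _ _ (by fun_prop),
    lintegral_lightConeMeasure_snocPoint (hF.indicator hP)]
  have e1 : ∀ (x : EuclideanSpace ℝ (Fin d)) (s : ℝ), ENNReal.ofReal (1 / √(‖x‖ ^ 2 + s ^ 2)) *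
        {w : EuclideanSpace ℝ (Fin (d + 1 + 1)) | 0 < initPoint w (Fin.last d)}.indicator F
          (snocPoint (snocPoint x s) √(‖x‖ ^ 2 + s ^ 2)) =
      (Set.Ioi (0 : ℝ)).indicator (fun s => ENNReal.ofReal (1 / √(‖x‖ ^ 2 + s ^ 2)) *
        F (snocPoint (snocPoint x s) √(‖x‖ ^ 2 + s ^ 2))) s := by
    intro x s
    by_cases hs : 0 < s
    · rw [Set.indicator_of_mem (Set.mem_Ioi.2 hs), Set.indicator_of_mem]
      rw [Set.mem_ofPred_eq, initPoint_snocPoint, snocPoint_last]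
      exact hs
    · have hs' : snocPoint (snocPoint x s) √(‖x‖ ^ 2 + s ^ 2) ∉
          {w : EuclideanSpace ℝ (Fin (d + 1 + 1)) | 0 < initPoint w (Fin.last d)} := by
        rw [Set.mem_ofPred_eq, initPoint_snocPoint, snocPoint_last]
        exact hs
      rw [Set.indicator_of_notMem hs', Set.indicator_of_notMem (s := Set.Ioi 0) hs, mul_zero]
  simp only [e1, lintegral_indicator measurableSet_Ioi]
  rw [lintegral_lintegral_swap (Measurable.aemeasurable (by fun_prop))]
  refine setLIntegral_congr_fun measurableSet_Ioi fun u hu => ?_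
  have hu : 0 < u := hu
  -- With `x = uη` at height `s = u`, the volume gives `u^d` and `1/τ` gives
  -- `u^{-1}(1+|η|²)^{-1/2}`: the conical density times that of the hyperboloid.
  have hsq : ∀ η : EuclideanSpace ℝ (Fin d), √(‖u • η‖ ^ 2 + u ^ 2) = u * √(1 + ‖η‖ ^ 2) := by
    intro η
    rw [norm_smul, Real.norm_of_nonneg hu.le, mul_pow, ← mul_add_one,
      Real.sqrt_mul (by positivity), Real.sqrt_sq hu.le, add_comm]
  change _ = ∫⁻ x : EuclideanSpace ℝ (Fin d), _
  rw [lintegral_euclidean_eq_smul (by fun_prop) hu, hyperboloidMeasure,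
    lintegral_map (by fun_prop) (by fun_prop),
    lintegral_withDensity_eq_lintegral_mul _ (by fun_prop) (by fun_prop),
    ← lintegral_const_mul _ (by fun_prop), ← lintegral_const_mul _ (by fun_prop)]
  refine lintegral_congr fun η => ?_
  simp only [Pi.mul_apply, hsq, ← snocPoint_smul, swapLastTwo_snocPoint]
  rw [← mul_assoc, ← mul_assoc, ← ENNReal.ofReal_mul (by positivity),
    ← ENNReal.ofReal_mul (by positivity), Real.rpow_sub hu, Real.rpow_natCast, Real.rpow_one]
  congr 2
  field_simp

/-- The parametrization of the line by a null coordinate. -/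
theorem lintegral_null_coordinate {m : ℝ} (hm : 0 < m) (G : ℝ → ℝ → ℝ≥0∞) :
    ∫⁻ s : ℝ, ENNReal.ofReal (1 / √(m ^ 2 + s ^ 2)) * G s √(m ^ 2 + s ^ 2) =
      ∫⁻ u in Set.Ioi (0 : ℝ), ENNReal.ofReal (1 / u) *
        G ((u - m ^ 2 / (2 * u)) / √2) ((u + m ^ 2 / (2 * u)) / √2) := by
  have h2 : 0 < √2 := by positivity
  have h22 : √2 ^ 2 = 2 := Real.sq_sqrt (by norm_num)
  -- Here `u = (τ + s)/√2`, and `m²/(2u)` is the other null coordinate `(τ - s)/√2`. Thus `φ`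
  -- expresses `s` through `u`, and its derivative yields `ds/τ = du/u`.
  let φ : ℝ → ℝ := fun u => (u - m ^ 2 / (2 * u)) / √2
  let φ' : ℝ → ℝ := fun u => (1 + m ^ 2 / (2 * u ^ 2)) / √2
  have hder : ∀ u ∈ Set.Ioi (0 : ℝ), HasDerivWithinAt φ (φ' u) (Set.Ioi 0) u := by
    intro u hu
    have hu : 0 < u := hu
    have h := ((hasDerivAt_id u).sub ((hasDerivAt_inv hu.ne').const_mul (m ^ 2 / 2))).div_const √2
    refine (h.congr_deriv ?_ |>.congr_of_eventuallyEq ?_).hasDerivWithinAt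
    · simp only [φ']
      field_simp
      ring
    · refine .of_forall fun v => ?_
      simp only [φ, Pi.sub_apply, id]
      rw [div_mul_eq_div_div, div_eq_mul_inv (m ^ 2 / 2)]
  have hτ : ∀ u : ℝ, 0 < u → √(m ^ 2 + φ u ^ 2) = (u + m ^ 2 / (2 * u)) / √2 := by
    intro u hu
    rw [Real.sqrt_eq_iff_mul_self_eq (by positivity) (by positivity)]
    simp only [φ]
    field_simp
    rw [h22]
    ring
  have hinj : Set.InjOn φ (Set.Ioi 0) := by
    intro u hu v hv huv
    have hu : 0 < u := hu
    have hv : 0 < v := hv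
    have h := hτ u hu
    rw [huv, hτ v hv] at h
    simp only [φ] at huv
    field_simp at huv h
    have hv' : u * v * (u - v) = 0 := by linarith
    have : u - v = 0 := by
      rcases mul_eq_zero.1 hv' with h | h
      · exact absurd h (by positivity)
      · exact h
    linarith
  have himg : φ '' Set.Ioi 0 = Set.univ := by
    refine Set.eq_univ_of_forall fun s => ?_
    have hs : 0 < √(m ^ 2 + s ^ 2) + s := by
      have : |s| < √(m ^ 2 + s ^ 2) := by
        rw [← Real.sqrt_sq_eq_abs]
        exact Real.sqrt_lt_sqrt (sq_nonneg _) (by nlinarith)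
      linarith [neg_abs_le s]
    refine ⟨(√(m ^ 2 + s ^ 2) + s) / √2, by simpa using div_pos hs h2, ?_⟩
    have hsq : √(m ^ 2 + s ^ 2) ^ 2 = m ^ 2 + s ^ 2 := Real.sq_sqrt (by positivity)
    simp only [φ]
    field_simp
    rw [h22]
    nlinarith
  have key := lintegral_image_eq_lintegral_abs_deriv_mul measurableSet_Ioi hder hinj
    fun s => ENNReal.ofReal (1 / √(m ^ 2 + s ^ 2)) * G s √(m ^ 2 + s ^ 2)
  rw [himg, Measure.restrict_univ] at key
  rw [key]
  refine setLIntegral_congr_fun measurableSet_Ioi fun u hu => ?_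
  have hu : 0 < u := hu
  have hφ' : 0 < φ' u := by positivity
  rw [hτ u hu, ← mul_assoc, ← ENNReal.ofReal_mul (abs_nonneg _), abs_of_pos hφ']
  congr 2
  simp only [φ']
  field_simp

/-- The light cone sliced by paraboloids. -/
theorem lintegral_conicalMeasure_paraboloidMeasure (hd : 1 ≤ d)
    {F : EuclideanSpace ℝ (Fin (d + 1 + 1)) → ℝ≥0∞} (hF : Measurable F) :
    ∫⁻ w, F (nullIsometry d w) ∂(conicalMeasure (paraboloidMeasure d) (Set.Ioi 0)) =
      ∫⁻ w, F w ∂(lightConeMeasure (d + 1)) := by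
  have hR : Measurable (nullIsometry d) := (nullIsometry d).continuous.measurable
  have : Nonempty (Fin d) := ⟨⟨0, hd⟩⟩
  rw [lintegral_conicalMeasure _ _ (by fun_prop), lintegral_lightConeMeasure_snocPoint hF]
  have e1 : ∀ᵐ x : EuclideanSpace ℝ (Fin d),
      ∫⁻ s : ℝ, ENNReal.ofReal (1 / √(‖x‖ ^ 2 + s ^ 2)) *
        F (snocPoint (snocPoint x s) √(‖x‖ ^ 2 + s ^ 2)) =
      ∫⁻ u in Set.Ioi (0 : ℝ), ENNReal.ofReal (1 / u) *
        F (snocPoint (snocPoint x ((u - ‖x‖ ^ 2 / (2 * u)) / √2))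
          ((u + ‖x‖ ^ 2 / (2 * u)) / √2)) := by
    -- The change of variable needs `x ≠ 0`, because the ray `x = 0`, `s < 0` has `u = 0`. That `x =
    -- 0` is negligible uses `d ≥ 1`.
    filter_upwards [compl_mem_ae_iff.2 (measure_singleton (0 : EuclideanSpace ℝ (Fin d)))] with x hx
    exact lintegral_null_coordinate (norm_pos_iff.2 hx) fun s t => F (snocPoint (snocPoint x s) t)
  rw [lintegral_congr_ae e1, lintegral_lintegral_swap (Measurable.aemeasurable (by fun_prop))]
  refine setLIntegral_congr_fun measurableSet_Ioi fun u hu => ?_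
  have hu : 0 < u := hu
  change _ = ∫⁻ x : EuclideanSpace ℝ (Fin d), _
  rw [lintegral_euclidean_eq_smul (by fun_prop) hu, paraboloidMeasure,
    lintegral_map (by fun_prop) (by fun_prop), ← lintegral_const_mul _ (by fun_prop),
    ← lintegral_const_mul _ (by fun_prop)]
  refine lintegral_congr fun η => ?_
  rw [← snocPoint_smul, nullIsometry_snocPoint, ← mul_assoc, ← ENNReal.ofReal_mul (by positivity)]
  -- The other null coordinate is `u` times the height of the paraboloid over `η`.
  have e2 : ‖u • η‖ ^ 2 / (2 * u) = u * (‖η‖ ^ 2 / 2) := by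
    rw [norm_smul, Real.norm_of_nonneg hu.le]
    field_simp
  rw [e2, Real.rpow_sub hu, Real.rpow_natCast, Real.rpow_one, div_eq_mul_one_div]

end ConeGeometry

/-! ### Symmetries of the cone and localization to compact pieces. -/

section ConeSymmetry

variable {n d : ℕ}

theorem mem_lightCone_iff {w : EuclideanSpace ℝ (Fin (n + 1))} :
    w ∈ lightCone n ↔ initPoint w ≠ 0 ∧ w (Fin.last n) = ‖initPoint w‖ := by
  constructor
  · rintro ⟨ξ, hξ, rfl⟩
    simpa using hξ
  · rintro ⟨h0, h1⟩
    exact ⟨initPoint w, h0, by rw [← h1, snocPoint_initPoint]⟩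

theorem snocPoint_mem_lightCone_iff {ξ : EuclideanSpace ℝ (Fin n)} {t : ℝ} :
    snocPoint ξ t ∈ lightCone n ↔ ξ ≠ 0 ∧ t = ‖ξ‖ := by
  rw [mem_lightCone_iff, initPoint_snocPoint, snocPoint_last]

theorem initPoint_add (v w : EuclideanSpace ℝ (Fin (n + 1))) :
    initPoint (v + w) = initPoint v + initPoint w := rfl

theorem initPoint_smul (c : ℝ) (w : EuclideanSpace ℝ (Fin (n + 1))) :
    initPoint (c • w) = c • initPoint w := rfl

/-- The isometry `(ξ, t) ↦ (L ξ, t)`. -/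
noncomputable def initIsometry (L : EuclideanSpace ℝ (Fin n) ≃ₗᵢ[ℝ] EuclideanSpace ℝ (Fin n)) :
    EuclideanSpace ℝ (Fin (n + 1)) ≃ₗᵢ[ℝ] EuclideanSpace ℝ (Fin (n + 1)) :=
  LinearIsometry.toLinearIsometryEquiv
    { toFun := fun w => snocPoint (L (initPoint w)) (w (Fin.last n))
      map_add' := fun v w => by
        rw [← snocPoint_add, ← map_add, initPoint_add, PiLp.add_apply]
      map_smul' := fun r w => by
        rw [RingHom.id_apply, ← snocPoint_smul, ← map_smul, initPoint_smul, PiLp.smul_apply,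
          smul_eq_mul]
      norm_map' := fun w => by
        rw [← sq_eq_sq₀ (norm_nonneg _) (norm_nonneg _)]
        change ‖snocPoint _ _‖ ^ 2 = _
        rw [norm_snocPoint_sq, L.norm_map, ← norm_snocPoint_sq, snocPoint_initPoint] } rfl

theorem initIsometry_apply (L : EuclideanSpace ℝ (Fin n) ≃ₗᵢ[ℝ] EuclideanSpace ℝ (Fin n))
    (w : EuclideanSpace ℝ (Fin (n + 1))) :
    initIsometry L w = snocPoint (L (initPoint w)) (w (Fin.last n)) := rfl

theorem map_initIsometry_lightConeMeasure
    (L : EuclideanSpace ℝ (Fin n) ≃ₗᵢ[ℝ] EuclideanSpace ℝ (Fin n)) :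
    (lightConeMeasure n).map (initIsometry L) = lightConeMeasure n := by
  have hM : Measurable (initIsometry L) := (initIsometry L).continuous.measurable
  refine Measure.ext_of_lintegral _ fun F hF => ?_
  rw [lintegral_map hF hM, lintegral_lightConeMeasure (by fun_prop), lintegral_lightConeMeasure hF,
    ← L.measurePreserving.lintegral_comp
      (f := fun ξ => ENNReal.ofReal (1 / ‖ξ‖) * F (snocPoint ξ ‖ξ‖)) (by fun_prop)]
  simp only [initIsometry_apply, initPoint_snocPoint, snocPoint_last, LinearIsometryEquiv.norm_map]

/-- Some coordinate of a vector is, up to its sign, comparable with the norm of the vector. -/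
theorem exists_finite_isometries (d : ℕ) :
    ∃ s : Set (EuclideanSpace ℝ (Fin (d + 1)) ≃ₗᵢ[ℝ] EuclideanSpace ℝ (Fin (d + 1))), s.Finite ∧
      ∀ ξ, ∃ L ∈ s, ‖ξ‖ ≤ (d + 1) * L ξ (Fin.last d) := by
  let T : Fin (d + 1) → EuclideanSpace ℝ (Fin (d + 1)) ≃ₗᵢ[ℝ] EuclideanSpace ℝ (Fin (d + 1)) :=
    fun i => LinearIsometryEquiv.piLpCongrLeft 2 ℝ ℝ (Equiv.swap i (Fin.last d))
  have hT : ∀ i ξ, T i ξ (Fin.last d) = ξ i := fun i ξ => by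
    simp [T, LinearIsometryEquiv.piLpCongrLeft_apply, Equiv.piCongrLeft']
  refine ⟨Set.range T ∪ Set.range fun i => (T i).trans (LinearIsometryEquiv.neg ℝ),
    (Set.finite_range _).union (Set.finite_range _), fun ξ => ?_⟩
  obtain ⟨i, hi⟩ : ∃ i, ‖ξ‖ ≤ (d + 1) * |ξ i| := by
    by_contra! hcon
    have h1 : ∀ i, ‖ξ i‖ ^ 2 ≤ (‖ξ‖ / (d + 1)) ^ 2 := fun i => by
      have : |ξ i| < ‖ξ‖ / (d + 1) := by
        rw [lt_div_iff₀ (by positivity)]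
        linarith [hcon i]
      rw [Real.norm_eq_abs]
      gcongr
    have h2 := Finset.sum_le_sum fun i (_ : i ∈ Finset.univ) => h1 i
    rw [← EuclideanSpace.norm_sq_eq, Finset.sum_const, Finset.card_univ, Fintype.card_fin,
      nsmul_eq_mul, div_pow] at h2
    have h0 : 0 < ‖ξ‖ := (mul_nonneg (by positivity) (abs_nonneg _)).trans_lt (hcon 0)
    -- Summing squares gives `‖ξ‖² ≤ ‖ξ‖²/(d+1)`, which is contradictory unless `d = 0`; there the
    -- norm is the absolute value of the only coordinate.
    have hd : (d : ℝ) = 0 := by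
      push_cast at h2
      field_simp at h2
      have : (0 : ℝ) ≤ d := d.cast_nonneg
      linarith
    have hd' : d = 0 := by exact_mod_cast hd
    subst hd'
    have := hcon 0
    rw [EuclideanSpace.norm_eq] at this
    simp [Real.sqrt_sq_eq_abs] at this
  rcases le_total 0 (ξ i) with h | h
  · exact ⟨T i, Or.inl ⟨i, rfl⟩, by rw [hT, ← abs_of_nonneg h]; exact hi⟩
  · refine ⟨_, Or.inr ⟨i, rfl⟩, ?_⟩
    simp only [LinearIsometryEquiv.trans_apply, LinearIsometryEquiv.coe_neg, PiLp.neg_apply, hT]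
    rwa [abs_of_nonpos h] at hi

theorem RestrictionBound.zero (N : ℕ) (p q : ℝ) :
    RestrictionBound (0 : Measure (EuclideanSpace ℝ (Fin N))) p q :=
  ⟨0, fun f => by simp⟩

theorem RestrictionBound.restrict_biUnion {N : ℕ} {ι : Type*} {s : Set ι} (hs : s.Finite)
    {σ : Measure (EuclideanSpace ℝ (Fin N))} {p q : ℝ} {A : ι → Set (EuclideanSpace ℝ (Fin N))}
    (h : ∀ i ∈ s, RestrictionBound (σ.restrict (A i)) p q) :
    RestrictionBound (σ.restrict (⋃ i ∈ s, A i)) p q := by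
  induction s, hs using Set.Finite.induction_on with
  | empty => simpa using RestrictionBound.zero N p q
  | insert _ _ ih =>
    rw [Set.biUnion_insert]
    exact ((h _ (Set.mem_insert _ _)).add (ih fun i hi => h i (Set.mem_insert_of_mem _ hi))).mono
      (Measure.restrict_union_le _ _)

/-- By symmetry it is enough to bound the compact pieces of the half `s > 0` of the light cone. -/
theorem restrictionBound_restrict_lightConeMeasure {p q : ℝ}
    (h : ∀ K : Set (EuclideanSpace ℝ (Fin (d + 1 + 1))), IsCompact K → K ⊆ lightCone (d + 1) →
      (∀ w ∈ K, 0 < initPoint w (Fin.last d)) →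
      RestrictionBound ((lightConeMeasure (d + 1)).restrict K) p q)
    {K : Set (EuclideanSpace ℝ (Fin (d + 1 + 1)))} (hK : IsCompact K)
    (hKc : K ⊆ lightCone (d + 1)) :
    RestrictionBound ((lightConeMeasure (d + 1)).restrict K) p q := by
  obtain ⟨s, hs, hsL⟩ := exists_finite_isometries d
  -- The condition is closed, so the pieces stay compact. On the cone, where `τ = |ξ| > 0`, it
  -- forces the last spatial coordinate to be positive after applying `L`.
  let A : (EuclideanSpace ℝ (Fin (d + 1)) ≃ₗᵢ[ℝ] EuclideanSpace ℝ (Fin (d + 1))) →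
      Set (EuclideanSpace ℝ (Fin (d + 1 + 1))) := fun L =>
    K ∩ {w | w (Fin.last (d + 1)) ≤ (d + 1) * L (initPoint w) (Fin.last d)}
  have hcover : K ⊆ ⋃ L ∈ s, A L := fun w hw => by
    obtain ⟨L, hL, hw'⟩ := hsL (initPoint w)
    refine Set.mem_biUnion hL ⟨hw, ?_⟩
    rw [Set.mem_ofPred_eq, (mem_lightCone_iff.1 (hKc hw)).2]
    exact hw'
  refine (RestrictionBound.restrict_biUnion hs fun L _ => ?_).mono
    (Measure.restrict_mono hcover le_rfl)
  have hAK : IsCompact (A L) := by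
    refine hK.inter_right (isClosed_le (PiLp.continuous_apply 2 _ _) (continuous_const.mul ?_))
    exact (PiLp.continuous_apply 2 _ (Fin.last d)).comp (L.continuous.comp continuous_initPoint)
  rw [← map_initIsometry_lightConeMeasure L.symm,
    Measure.restrict_map (initIsometry L.symm).continuous.measurable hAK.measurableSet]
  refine RestrictionBound.map (h _ ((initIsometry L.symm).toHomeomorph.isCompact_preimage.2 hAK)
    (fun w hw => ?_) fun w hw => ?_) _
  · have hw' : initIsometry L.symm w ∈ lightCone (d + 1) := hKc hw.1
    rw [initIsometry_apply, snocPoint_mem_lightCone_iff, LinearIsometryEquiv.norm_map] at hw'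
    rw [mem_lightCone_iff]
    exact ⟨fun h0 => hw'.1 (by rw [h0, map_zero]), hw'.2⟩
  · have hw1 : initIsometry L.symm w ∈ lightCone (d + 1) := hKc hw.1
    have hw2 : initIsometry L.symm w ∈ {w : EuclideanSpace ℝ (Fin (d + 1 + 1)) |
        w (Fin.last (d + 1)) ≤ (d + 1) * L (initPoint w) (Fin.last d)} := hw.2
    rw [initIsometry_apply, snocPoint_mem_lightCone_iff] at hw1
    rw [Set.mem_ofPred_eq, initIsometry_apply, snocPoint_last, initPoint_snocPoint,
      LinearIsometryEquiv.apply_symm_apply, hw1.2] at hw2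
    have h3 : 0 < (d + 1 : ℝ) * initPoint w (Fin.last d) := (norm_pos_iff.2 hw1.1).trans_le hw2
    exact pos_of_mul_pos_right h3 (by positivity)

/-- If the slice coordinates `(η, u)` of points of `K` all lie in `S × [a, b]`, the part of the cone
in `K` is seen only by the conical measure over `S` and `[a, b]`. -/
theorem map_conicalMeasure_restrict_le {σ : Measure (EuclideanSpace ℝ (Fin (d + 1)))} [SFinite σ]
    (R : EuclideanSpace ℝ (Fin (d + 1 + 1)) ≃ₗᵢ[ℝ] EuclideanSpace ℝ (Fin (d + 1 + 1)))
    {K : Set (EuclideanSpace ℝ (Fin (d + 1 + 1)))} (hK : MeasurableSet K)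
    {S : Set (EuclideanSpace ℝ (Fin (d + 1)))} (hS : MeasurableSet S) {a b : ℝ}
    (h : ∀ u η, 0 < u → R (snocPoint (u • η) u) ∈ K → η ∈ S ∧ u ∈ Set.Icc a b) :
    ((conicalMeasure σ (Set.Ioi 0)).map R).restrict K ≤
      (conicalMeasure (σ.restrict S) (Set.Icc a b)).map R := by
  have hR : Measurable R := R.continuous.measurable
  refine Measure.le_iff.2 fun A hA => ?_
  have hAK : Measurable ((A ∩ K).indicator (1 : EuclideanSpace ℝ (Fin (d + 1 + 1)) → ℝ≥0∞)) :=
    measurable_one.indicator (hA.inter hK)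
  have hA1 : Measurable (A.indicator (1 : EuclideanSpace ℝ (Fin (d + 1 + 1)) → ℝ≥0∞)) :=
    measurable_one.indicator hA
  rw [Measure.restrict_apply hA, ← lintegral_indicator_one (hA.inter hK),
    ← lintegral_indicator_one hA, lintegral_map hAK hR, lintegral_map hA1 hR,
    lintegral_conicalMeasure _ _ (by fun_prop), lintegral_conicalMeasure _ _ (by fun_prop),
    ← lintegral_indicator measurableSet_Ioi, ← lintegral_indicator measurableSet_Icc]
  refine lintegral_mono fun u => ?_
  refine Set.indicator_apply_le' (fun hu => ?_) fun _ => zero_le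
  have hu : 0 < u := hu
  by_cases hab : u ∈ Set.Icc a b
  · rw [Set.indicator_of_mem hab, ← lintegral_indicator hS]
    gcongr with η
    refine Set.indicator_apply_le' (fun hη => ?_) fun _ => zero_le
    rw [Set.indicator_of_mem (h u η hu hη.2).1, Set.indicator_of_mem hη.1]
  · have : ∀ η, (A ∩ K).indicator (1 : EuclideanSpace ℝ (Fin (d + 1 + 1)) → ℝ≥0∞)
        (R (snocPoint (u • η) u)) = 0 := fun η =>
      Set.indicator_of_notMem (fun hη => hab (h u η hu hη.2).2) _
    simp [this]

/-- Slicing of the compact pieces of the light cone. -/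
theorem restrictionBound_restrict_lightConeMeasure_of_slices
    {σ : Measure (EuclideanSpace ℝ (Fin (d + 1)))} [SFinite σ] {p q r : ℝ}
    (hpr : p.HolderConjugate r) (hp2 : p < 2) (hq0 : 0 < q) (hqr : q ≤ r)
    {S : Set (EuclideanSpace ℝ (Fin (d + 1)))}
    (hS : ∀ K, IsCompact K → K ⊆ S → RestrictionBound (σ.restrict K) p q)
    (R : EuclideanSpace ℝ (Fin (d + 1 + 1)) ≃ₗᵢ[ℝ] EuclideanSpace ℝ (Fin (d + 1 + 1)))
    {K : Set (EuclideanSpace ℝ (Fin (d + 1 + 1)))} (hK : IsCompact K)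
    (hpos : ∀ w ∈ K, 0 < R.symm w (Fin.last (d + 1)))
    (hmem : ∀ w ∈ K, (R.symm w (Fin.last (d + 1)))⁻¹ • initPoint (R.symm w) ∈ S)
    (hR : (lightConeMeasure (d + 1)).restrict K ≤
      ((conicalMeasure σ (Set.Ioi 0)).map R).restrict K) :
    RestrictionBound ((lightConeMeasure (d + 1)).restrict K) p q := by
  rcases K.eq_empty_or_nonempty with rfl | hne
  · simpa using RestrictionBound.zero _ p q
  have hcont : Continuous fun w => R.symm w (Fin.last (d + 1)) :=
    (PiLp.continuous_apply 2 _ _).comp R.symm.continuous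
  obtain ⟨v, hv, hmin⟩ := hK.exists_isMinOn hne hcont.continuousOn
  obtain ⟨v', hv', hmax⟩ := hK.exists_isMaxOn hne hcont.continuousOn
  -- These are the directions `η = x/u` of the points of `K`, where `x` denotes all coordinates but
  -- the axial one. Compactness of `K` bounds `u` away from `0`, making `S'` compact; the range of
  -- `u` lies between its minimum and maximum on `K`.
  set S' := (fun w => (R.symm w (Fin.last (d + 1)))⁻¹ • initPoint (R.symm w)) '' K
  have hS'c : IsCompact S' := hK.image_of_continuousOn
    ((hcont.continuousOn.inv₀ fun w hw => (hpos w hw).ne').smul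
      (continuous_initPoint.comp R.symm.continuous).continuousOn)
  have hS' : S' ⊆ S := Set.image_subset_iff.2 hmem
  refine (((hS S' hS'c hS').conicalMeasure_Icc hpr hp2 hq0 hqr (hpos v hv)
    (R.symm v' (Fin.last (d + 1)))).map R).mono (hR.trans ?_)
  refine map_conicalMeasure_restrict_le R hK.measurableSet hS'c.measurableSet
    fun u η hu hmemK => ⟨⟨_, hmemK, ?_⟩, ?_, ?_⟩
  · simp [hu.ne']
  · simpa using hmin hmemK
  · simpa using hmax hmemK

theorem conicalMeasure_sphereMeasure :
    conicalMeasure (sphereMeasure (d + 1)) (Set.Ioi 0) = lightConeMeasure (d + 1) :=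
  Measure.ext_of_lintegral _ fun _ hF => lintegral_conicalMeasure_sphereMeasure hF

theorem map_conicalMeasure_paraboloidMeasure (hd : 1 ≤ d) :
    (conicalMeasure (paraboloidMeasure d) (Set.Ioi 0)).map (nullIsometry d) =
      lightConeMeasure (d + 1) :=
  Measure.ext_of_lintegral _ fun _ hF => by
    rw [lintegral_map hF (nullIsometry d).continuous.measurable,
      lintegral_conicalMeasure_paraboloidMeasure hd hF]

theorem measurableSet_initPoint_last_pos :
    MeasurableSet {w : EuclideanSpace ℝ (Fin (d + 1 + 1)) | 0 < initPoint w (Fin.last d)} := by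
  simp only [initPoint_apply]
  exact measurableSet_lt measurable_const (by fun_prop)

theorem map_conicalMeasure_hyperboloidMeasure :
    (conicalMeasure (hyperboloidMeasure d) (Set.Ioi 0)).map (swapLastTwo d) =
      (lightConeMeasure (d + 1)).restrict {w | 0 < initPoint w (Fin.last d)} :=
  Measure.ext_of_lintegral _ fun _ hF => by
    rw [lintegral_map hF (swapLastTwo d).continuous.measurable,
      lintegral_conicalMeasure_hyperboloidMeasure hF,
      lintegral_indicator measurableSet_initPoint_last_pos]

theorem swapLastTwo_symm_snocPoint (x : EuclideanSpace ℝ (Fin d)) (s t : ℝ) :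
    (swapLastTwo d).symm (snocPoint (snocPoint x s) t) = snocPoint (snocPoint x t) s := by
  rw [LinearIsometryEquiv.symm_apply_eq, swapLastTwo_snocPoint]

theorem nullIsometry_symm_snocPoint (x : EuclideanSpace ℝ (Fin d)) (s t : ℝ) :
    (nullIsometry d).symm (snocPoint (snocPoint x s) t) =
      snocPoint (snocPoint x ((t - s) / √2)) ((t + s) / √2) := by
  rw [LinearIsometryEquiv.symm_apply_eq, nullIsometry_snocPoint]
  have h : √2 * √2 = 2 := Real.mul_self_sqrt (by norm_num)
  congr 2
  · rw [← sub_div, div_div, h]; ring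
  · rw [← add_div, div_div, h]; ring

theorem exists_eq_snocPoint_of_mem_lightCone {w : EuclideanSpace ℝ (Fin (d + 1 + 1))}
    (hw : w ∈ lightCone (d + 1)) : ∃ (x : EuclideanSpace ℝ (Fin d)) (s t : ℝ), 0 < t ∧
      t ^ 2 = ‖x‖ ^ 2 + s ^ 2 ∧ initPoint w (Fin.last d) = s ∧
      w = snocPoint (snocPoint x s) t := by
  obtain ⟨ξ, hξ, rfl⟩ := hw
  refine ⟨initPoint ξ, ξ (Fin.last d), ‖ξ‖, norm_pos_iff.2 hξ, ?_, ?_, ?_⟩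
  · rw [← norm_snocPoint_sq, snocPoint_initPoint]
  · rw [initPoint_snocPoint]
  · rw [snocPoint_initPoint]

theorem inv_smul_mem_paraboloid {w : EuclideanSpace ℝ (Fin (d + 1 + 1))}
    (hw : w ∈ lightCone (d + 1)) (hs : 0 < initPoint w (Fin.last d)) :
    0 < (nullIsometry d).symm w (Fin.last (d + 1)) ∧
      ((nullIsometry d).symm w (Fin.last (d + 1)))⁻¹ • initPoint ((nullIsometry d).symm w) ∈
        paraboloid d := by
  obtain ⟨x, s, t, ht, htx, hws, rfl⟩ := exists_eq_snocPoint_of_mem_lightCone hw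
  rw [hws] at hs
  rw [nullIsometry_symm_snocPoint, snocPoint_last, initPoint_snocPoint]
  have h : √2 * √2 = 2 := Real.mul_self_sqrt (by norm_num)
  refine ⟨by positivity, ((t + s) / √2)⁻¹ • x, ?_⟩
  rw [← snocPoint_smul]
  congr 1
  rw [norm_smul, Real.norm_of_nonneg (by positivity), mul_pow]
  have hx : ‖x‖ ^ 2 = (t - s) * (t + s) := by linarith
  rw [hx]
  field_simp
  rw [sq, h]
  ring

theorem inv_smul_mem_hyperboloid {w : EuclideanSpace ℝ (Fin (d + 1 + 1))}
    (hw : w ∈ lightCone (d + 1)) (hs : 0 < initPoint w (Fin.last d)) :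
    0 < (swapLastTwo d).symm w (Fin.last (d + 1)) ∧
      ((swapLastTwo d).symm w (Fin.last (d + 1)))⁻¹ • initPoint ((swapLastTwo d).symm w) ∈
        hyperboloid d := by
  obtain ⟨x, s, t, ht, htx, hws, rfl⟩ := exists_eq_snocPoint_of_mem_lightCone hw
  rw [hws] at hs
  rw [swapLastTwo_symm_snocPoint, snocPoint_last, initPoint_snocPoint]
  refine ⟨hs, s⁻¹ • x, ?_⟩
  rw [← snocPoint_smul]
  congr 1
  rw [eq_comm, Real.sqrt_eq_iff_mul_self_eq (by positivity) (by positivity), norm_smul,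
    Real.norm_of_nonneg (by positivity)]
  field_simp
  linarith

/-- Negligibility of `s = 0` means that the halves `s > 0` and `s < 0`, exchanged by `ξ ↦ -ξ`, carry
the whole measure. -/
theorem lightConeMeasure_initPoint_last_eq_zero :
    lightConeMeasure (d + 1) {w | initPoint w (Fin.last d) = 0} = 0 := by
  have hm : MeasurableSet {w : EuclideanSpace ℝ (Fin (d + 1 + 1)) |
      initPoint w (Fin.last d) = 0} := by
    simp only [initPoint_apply]
    exact measurableSet_eq_fun (by fun_prop) measurable_const
  rw [← lintegral_indicator_one hm, lintegral_lightConeMeasure_snocPoint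
    (measurable_one.indicator hm)]
  refine lintegral_eq_zero_of_ae_eq_zero (.of_forall fun x => ?_)
  refine lintegral_eq_zero_of_ae_eq_zero ?_
  filter_upwards [compl_mem_ae_iff.2 (measure_singleton (0 : ℝ))] with s hs
  rw [Set.indicator_of_notMem, mul_zero]
  · rfl
  · rw [Set.mem_ofPred_eq, initPoint_snocPoint, snocPoint_last]
    exact hs

/-- By symmetry it is enough to bound the half `s > 0` of the light cone. -/
theorem restrictionBound_lightConeMeasure_of_restrict {p q : ℝ}
    (h : RestrictionBound ((lightConeMeasure (d + 1)).restrict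
      {w | 0 < initPoint w (Fin.last d)}) p q) :
    RestrictionBound (lightConeMeasure (d + 1)) p q := by
  set P := {w : EuclideanSpace ℝ (Fin (d + 1 + 1)) | 0 < initPoint w (Fin.last d)} with hP
  set Q := {w : EuclideanSpace ℝ (Fin (d + 1 + 1)) | initPoint w (Fin.last d) < 0} with hQ
  have hQm : MeasurableSet Q := by
    simp only [hQ, initPoint_apply]
    exact measurableSet_lt (by fun_prop) measurable_const
  set M := initIsometry (LinearIsometryEquiv.neg ℝ (E := EuclideanSpace ℝ (Fin (d + 1))))
  have hMQ : M ⁻¹' Q = P := by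
    ext w
    simp only [hQ, hP, Set.mem_preimage, Set.mem_ofPred_eq, M, initIsometry_apply,
      initPoint_snocPoint, LinearIsometryEquiv.coe_neg, PiLp.neg_apply, neg_lt_zero]
  have hQmap : (lightConeMeasure (d + 1)).restrict Q =
      ((lightConeMeasure (d + 1)).restrict P).map M := by
    conv_lhs => rw [← map_initIsometry_lightConeMeasure
      (LinearIsometryEquiv.neg ℝ (E := EuclideanSpace ℝ (Fin (d + 1))))]
    rw [Measure.restrict_map M.continuous.measurable hQm, hMQ]
  refine (h.add (h.map M)).mono ?_
  rw [← hQmap]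
  conv_lhs => rw [← Measure.restrict_add_restrict_compl (μ := lightConeMeasure (d + 1))
    measurableSet_initPoint_last_pos]
  refine add_le_add le_rfl (Measure.restrict_mono' ?_ le_rfl)
  have hnull : ∀ᵐ w ∂(lightConeMeasure (d + 1)), initPoint w (Fin.last d) ≠ 0 := by
    rw [ae_iff]
    simpa using lightConeMeasure_initPoint_last_eq_zero (d := d)
  filter_upwards [hnull] with w hw hwP
  exact lt_of_le_of_ne (not_lt.1 hwP) hw

end ConeSymmetry

/-! ### The trivial endpoint `p = 1`. -/

section Endpoint

variable {N : ℕ}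

theorem norm_fourier_le_integral_norm (f : 𝓢(EuclideanSpace ℝ (Fin N), ℂ))
    (ξ : EuclideanSpace ℝ (Fin N)) :
    ‖𝓕 (f : EuclideanSpace ℝ (Fin N) → ℂ) ξ‖ ≤ ∫ x, ‖f x‖ := by
  rw [Real.fourier_eq]
  refine (norm_integral_le_integral_norm _).trans (le_of_eq ?_)
  simp_rw [Circle.norm_smul]

/-- The hypothesis covers two cases at once: a finite measure, and `q = ∞`, where `q.toReal⁻¹ = 0`
makes the power equal to `1` for any measure. -/
theorem restrictionEstimate_one {σ : Measure (EuclideanSpace ℝ (Fin N))} {q : ℝ≥0∞}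
    (h : σ Set.univ ^ q.toReal⁻¹ ≠ ∞) : RestrictionEstimate σ 1 q := by
  refine ⟨(σ Set.univ ^ q.toReal⁻¹).toNNReal, fun f => ?_⟩
  rw [ENNReal.coe_toNNReal h, eLpNorm_one_eq_lintegral_enorm]
  refine (eLpNorm_le_of_ae_bound (.of_forall (norm_fourier_le_integral_norm f))).trans
    (le_of_eq ?_)
  rw [ofReal_integral_norm_eq_lintegral_enorm f.integrable]

/-- A compact subset of the cone avoids the apex, so the density `1/|ξ|` is bounded on it. -/
theorem lightConeMeasure_lt_top {n : ℕ} {K : Set (EuclideanSpace ℝ (Fin (n + 1)))}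
    (hK : IsCompact K) (hKc : K ⊆ lightCone n) : lightConeMeasure n K < ∞ := by
  rcases K.eq_empty_or_nonempty with rfl | hne
  · simp
  obtain ⟨v, hv, hmin⟩ := hK.exists_isMinOn hne
    (f := fun w : EuclideanSpace ℝ (Fin (n + 1)) => w (Fin.last n))
    (PiLp.continuous_apply 2 _ _).continuousOn
  have hpos : 0 < v (Fin.last n) := by
    obtain ⟨h0, h1⟩ := mem_lightCone_iff.1 (hKc hv)
    rw [h1]
    exact norm_pos_iff.2 h0
  have hK' : IsCompact (initPoint '' K) := hK.image continuous_initPoint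
  rw [← lintegral_indicator_one hK.measurableSet,
    lintegral_lightConeMeasure (measurable_one.indicator hK.measurableSet)]
  refine lt_of_le_of_lt (b := ∫⁻ ξ, (initPoint '' K).indicator
    (fun _ => ENNReal.ofReal (1 / v (Fin.last n))) ξ) (lintegral_mono fun ξ => ?_) ?_
  · by_cases hξ : snocPoint ξ ‖ξ‖ ∈ K
    · rw [Set.indicator_of_mem hξ, Set.indicator_of_mem
        (show ξ ∈ initPoint '' K from ⟨_, hξ, initPoint_snocPoint _ _⟩),
        Pi.one_apply, mul_one]
      have : v (Fin.last n) ≤ ‖ξ‖ := by simpa using hmin hξ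
      gcongr
    · simp [Set.indicator_of_notMem hξ]
  · rw [lintegral_indicator hK'.measurableSet, setLIntegral_const]
    exact ENNReal.mul_lt_top ENNReal.ofReal_lt_top hK'.measure_lt_top

end Endpoint

/-! ### Translation of the exponents and conclusion. -/

section Main

variable {d : ℕ} {p p' q : ℝ≥0∞}

theorem two_lt_of_two_mul_div_lt (hd : 1 ≤ d)
    (h : 2 * ((d + 1 : ℕ) : ℝ≥0∞) / (((d + 1 : ℕ) : ℝ≥0∞) - 1) < p') :
    2 * (d + 1 : ℝ≥0∞) / d < p' ∧ 2 < p' := by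
  have hd0 : (d : ℝ≥0∞) ≠ 0 := by exact_mod_cast (by omega : d ≠ 0)
  rw [Nat.cast_add_one, ENNReal.add_sub_cancel_right ENNReal.one_ne_top] at h
  refine ⟨h, lt_of_le_of_lt ?_ h⟩
  rw [ENNReal.le_div_iff_mul_le (Or.inl hd0) (Or.inl (by simp))]
  gcongr
  exact le_self_add

theorem exists_conjugate_exponents (hp : ENNReal.HolderConjugate p p') (hp' : p' ≠ ∞)
    (h2 : 2 < p') : p ≠ 0 ∧ p ≠ ∞ ∧ p.toReal.HolderConjugate p'.toReal ∧ p.toReal < 2 := by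
  have h2' : 2 < p'.toReal := by
    simpa using (ENNReal.toReal_lt_toReal (by simp) hp').2 h2
  have := hp.symm
  have hc : p'.toReal.HolderConjugate p.toReal :=
    ENNReal.HolderConjugate.toReal (by linarith)
  have hpos := hc.symm.pos
  have hmul := hc.mul_eq_add
  refine ⟨fun h => by simp [h] at hpos, fun h => by simp [h] at hpos, hc.symm, by nlinarith⟩

theorem eq_one_of_conjugate_top (hp : ENNReal.HolderConjugate p ∞) : p = 1 := by
  have h := hp.inv_add_inv_eq_inv
  simpa using h

theorem compactRestrictionEstimate_lightCone (hd : 1 ≤ d) (hp : ENNReal.HolderConjugate p p')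
    (hq : 1 ≤ q) (hr : RestrictionRange (d + 1) p' q)
    (h : RestrictionEstimate (sphereMeasure (d + 1)) p q ∨
      CompactRestrictionEstimate (paraboloid d) (paraboloidMeasure d) p q ∨
      CompactRestrictionEstimate (hyperboloid d) (hyperboloidMeasure d) p q) :
    CompactRestrictionEstimate (lightCone (d + 1)) (lightConeMeasure (d + 1)) p q := by
  intro K hK hKc
  obtain ⟨hr1, hr2⟩ := hr
  obtain ⟨-, h2⟩ := two_lt_of_two_mul_div_lt hd hr2
  rcases eq_or_ne p' ∞ with rfl | hp'
  · rw [eq_one_of_conjugate_top hp]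
    refine restrictionEstimate_one (ENNReal.rpow_ne_top_of_nonneg (by positivity) ?_)
    rw [Measure.restrict_apply_univ]
    exact (lightConeMeasure_lt_top hK hKc).ne
  obtain ⟨hp0, hpt, hc, hp2⟩ := exists_conjugate_exponents hp hp' h2
  have hd0 : (d : ℝ≥0∞) ≠ 0 := by exact_mod_cast (by omega : d ≠ 0)
  rw [Nat.cast_add_one, ENNReal.add_sub_cancel_right ENNReal.one_ne_top] at hr1
  -- The range condition gives `q ≤ p' d/(d+2)`; only the weaker `q ≤ p'` is needed for compact
  -- pieces.
  have hqp : q ≤ p' := by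
    rw [ENNReal.div_le_iff hd0 (by simp)] at hr1
    refine hr1.trans ?_
    rw [← ENNReal.mul_div_right_comm]
    refine ENNReal.div_le_of_le_mul ?_
    gcongr
    exact le_self_add.trans le_self_add
  have hq0 : q ≠ 0 := (zero_lt_one.trans_le hq).ne'
  have hqt : q ≠ ∞ := ne_top_of_le_ne_top hp' hqp
  have hqr : q.toReal ≤ p'.toReal := ENNReal.toReal_mono hp' hqp
  have hq0' : 0 < q.toReal := ENNReal.toReal_pos hq0 hqt
  unfold CompactRestrictionEstimate at h
  simp only [restrictionEstimate_iff_restrictionBound hp0 hpt hq0 hqt] at h ⊢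
  refine restrictionBound_restrict_lightConeMeasure (fun K hK hKc hpos => ?_) hK hKc
  rcases h with h | h | h
  · refine restrictionBound_restrict_lightConeMeasure_of_slices hc hp2 hq0' hqr (S := Set.univ)
      (fun _ _ _ => h.mono Measure.restrict_le_self) (LinearIsometryEquiv.refl ℝ _) hK
      (fun w hw => ?_) (fun w _ => trivial) ?_
    · obtain ⟨h0, h1⟩ := mem_lightCone_iff.1 (hKc hw)
      change 0 < w (Fin.last (d + 1))
      rw [h1]
      exact norm_pos_iff.2 h0
    · rw [conicalMeasure_sphereMeasure, LinearIsometryEquiv.coe_refl, Measure.map_id]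
  · refine restrictionBound_restrict_lightConeMeasure_of_slices hc hp2 hq0' hqr h (nullIsometry d)
      hK (fun w hw => (inv_smul_mem_paraboloid (hKc hw) (hpos w hw)).1)
      (fun w hw => (inv_smul_mem_paraboloid (hKc hw) (hpos w hw)).2) ?_
    rw [map_conicalMeasure_paraboloidMeasure hd]
  · refine restrictionBound_restrict_lightConeMeasure_of_slices hc hp2 hq0' hqr h (swapLastTwo d)
      hK (fun w hw => (inv_smul_mem_hyperboloid (hKc hw) (hpos w hw)).1)
      (fun w hw => (inv_smul_mem_hyperboloid (hKc hw) (hpos w hw)).2) ?_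
    have hsub : K ⊆ {w | 0 < initPoint w (Fin.last d)} := hpos
    rw [map_conicalMeasure_hyperboloidMeasure, Measure.restrict_restrict_of_subset hsub]

theorem restrictionEstimate_lightCone (hd : 1 ≤ d) (hp : ENNReal.HolderConjugate p p')
    (hq : 1 ≤ q) (hr : ScaleInvariantRange (d + 1) p' q)
    (h : RestrictionEstimate (sphereMeasure (d + 1)) p q ∨
      RestrictionEstimate (paraboloidMeasure d) p q ∨
      RestrictionEstimate (hyperboloidMeasure d) p q) :
    RestrictionEstimate (lightConeMeasure (d + 1)) p q := by
  obtain ⟨hr1, hr2⟩ := hr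
  obtain ⟨h3, h2⟩ := two_lt_of_two_mul_div_lt hd hr2
  have hd0 : (d : ℝ≥0∞) ≠ 0 := by exact_mod_cast (by omega : d ≠ 0)
  rw [Nat.cast_add_one, ENNReal.add_sub_cancel_right ENNReal.one_ne_top] at hr1
  rcases eq_or_ne p' ∞ with rfl | hp'
  · have hqt : q = ∞ := by
      rw [ENNReal.top_div_of_ne_top (by finiteness), eq_comm, ENNReal.div_eq_top] at hr1
      rcases hr1 with hr1 | hr1
      · exact absurd hr1.2 hd0
      · exact hr1.1
    rw [eq_one_of_conjugate_top hp]
    exact restrictionEstimate_one (by simp [hqt])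
  obtain ⟨hp0, hpt, hc, hp2⟩ := exists_conjugate_exponents hp hp' h2
  have hq0 : q ≠ 0 := (zero_lt_one.trans_le hq).ne'
  have hqt : q ≠ ∞ := by
    rintro rfl
    rw [ENNReal.top_div_of_ne_top (by finiteness), ENNReal.div_eq_top] at hr1
    rcases hr1 with hr1 | hr1
    · simp at hr1
    · exact hp' hr1.1
  have hdpos : (0 : ℝ) < d := by exact_mod_cast hd
  have hqr : q.toReal * (d + 2) = p'.toReal * d := by
    have := congrArg ENNReal.toReal hr1
    rw [ENNReal.toReal_div, ENNReal.toReal_div, ENNReal.toReal_natCast,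
      ENNReal.toReal_add (by finiteness) (by finiteness),
      ENNReal.toReal_add (by finiteness) (by finiteness), ENNReal.toReal_natCast,
      ENNReal.toReal_one] at this
    field_simp at this
    linarith
  -- The condition `p' > 2(d+1)/d` reads `p < 2(d+1)/(d+2)`, and with the scaling relation it also
  -- reads `q > 2(d+1)/(d+2)`.
  have hpq : p.toReal ≤ q.toReal := by
    have h4 := (ENNReal.toReal_lt_toReal
      (ENNReal.div_ne_top (by finiteness) hd0) hp').2 h3
    rw [ENNReal.toReal_div, ENNReal.toReal_mul, ENNReal.toReal_ofNat, ENNReal.toReal_natCast,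
      ENNReal.toReal_add (by finiteness) (by finiteness), ENNReal.toReal_natCast,
      ENNReal.toReal_one, div_lt_iff₀ hdpos] at h4
    have hmul := hc.mul_eq_add
    have hp1 := hc.lt
    have h5 : p.toReal * (d + 2) < 2 * (d + 1) := by nlinarith
    nlinarith
  simp only [restrictionEstimate_iff_restrictionBound hp0 hpt hq0 hqt] at h ⊢
  rcases h with h | h | h
  · rw [← conicalMeasure_sphereMeasure]
    exact h.conicalMeasure_Ioi hc hp2 hqr hpq
  · rw [← map_conicalMeasure_paraboloidMeasure hd]
    exact (h.conicalMeasure_Ioi hc hp2 hqr hpq).map _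
  · refine restrictionBound_lightConeMeasure_of_restrict ?_
    rw [← map_conicalMeasure_hyperboloidMeasure]
    exact (h.conicalMeasure_Ioi hc hp2 hqr hpq).map _

end Main

/-- With `n = d + 1 ≥ 2`: restriction for the sphere, the paraboloid or the hyperboloid in `ℝ^n`
implies restriction for the light cone in `ℝ^{n+1}`, with the same exponents. -/
theorem theorem1p1 (d : ℕ) (hd : 1 ≤ d) (p p' q : ℝ≥0∞) (hp : ENNReal.HolderConjugate p p')
    (hq : 1 ≤ q) :
    (RestrictionRange (d + 1) p' q →
      (RestrictionEstimate (sphereMeasure (d + 1)) p q ∨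
        CompactRestrictionEstimate (paraboloid d) (paraboloidMeasure d) p q ∨
        CompactRestrictionEstimate (hyperboloid d) (hyperboloidMeasure d) p q) →
      CompactRestrictionEstimate (lightCone (d + 1)) (lightConeMeasure (d + 1)) p q) ∧
    (ScaleInvariantRange (d + 1) p' q →
      (RestrictionEstimate (sphereMeasure (d + 1)) p q ∨
        RestrictionEstimate (paraboloidMeasure d) p q ∨
        RestrictionEstimate (hyperboloidMeasure d) p q) →
      RestrictionEstimate (lightConeMeasure (d + 1)) p q) :=
  ⟨compactRestrictionEstimate_lightCone hd hp hq, restrictionEstimate_lightCone hd hp hq⟩
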